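/- Let $E$ be a CM field of degree $2g$ over $\mathbb{Q}$, with complex conjugation $\rho$ and maximal totally real subfield $F$. Let $E^c\supseteq F^c$ be the Galois closures of $E$ and $F$ over $\mathbb{Q}$. Let $\Sigma\subset \mathrm{Hom}(E,E^c)$ be a CM type, i.e. $\mathrm{Hom}(E,E^c)=\Sigma\sqcup\Sigma^{\rho}$ with $\Sigma^\rho=\{\phi\circ\rho : \phi\in\Sigma\}$, and let $E'\subseteq E^c$ be its reflex field, the fixed field of $\{\sigma\in\mathrm{Gal}(E^c/\mathbb{Q}) : \sigma\Sigma=\Sigma\}$. For a number field $K$ let $R_K=\mathrm{Res}_{K/\mathbb{Q}}\mathbb{G}_{m,K}$, and write $X_*(T)$ for the group of cocharacters over $\overline{\mathbb{Q}}$ of a subgroup $T$ of $R_K$. Let $U_E=\{x\in R_E : x x^{\rho}=1\}$, and let $GU_E\subseteq R_E$ be the algebraic subgroup generated by $U_E$ and $\mathbb{G}_{m,\mathbb{Q}}$. Let $\mu:\mathbb{G}_{m,E'}\to R_{E,E'}$ be the cocharacter $\sum_{\phi\in\Sigma}[\phi]$, and let $r=N_{E'/\mathbb{Q}}\circ \mathrm{Res}_{E'/\mathbb{Q}}(\mu):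 R_{E'}\to R_E$ be the reciprocity morphism; on cocharacters it sends $[\beta|_{E'}]$, for $\beta\in \mathrm{Gal}(E^c/\mathbb{Q})$, to $\sum_{\phi\in\Sigma}[\beta\circ\phi]$. Let $L_\mu = X_*(r)(X_*(R_{E'}))\subseteq X_*(R_E)$. Suppose that there is an exact sequence $$1\to(\mathbb{Z}/2)^v\to \mathrm{Gal}(E^c/\mathbb{Q})\to \mathrm{Gal}(F^c/\mathbb{Q})\to 1$$ in which the second map is restriction to $F^c$, and that $v=g$. Then $L_\mu=X_*(GU_E)$, and the kernel of $r$ is connected. -/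

import Mathlib

open scoped TensorProduct

universe u

namespace CMTorus

/-! ### Weil restrictions of the multiplicative group, as functors of points -/

section Functors

/-- The group `R_K(A) = (K ⊗_ℚ A)ˣ` of `A`-points of the torus `R_K = Res_{K/ℚ} 𝔾_m`. -/
abbrev ResPoints (K A : Type u) [Field K] [Algebra ℚ K] [CommRing A] [Algebra ℚ A] : Type u :=
  (K ⊗[ℚ] A)ˣ

/-- Functoriality of `A ↦ R_K(A)`. -/
noncomputable def ResPoints.map (K : Type u) [Field K] [Algebra ℚ K] {A B : Type u}
    [CommRing A] [Algebra ℚ A] [CommRing B] [Algebra ℚ B] (f : A →ₐ[ℚ] B) :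
    ResPoints K A →* ResPoints K B :=
  Units.map (Algebra.TensorProduct.map (AlgHom.id ℚ K) f : K ⊗[ℚ] A →* K ⊗[ℚ] B)

/-- A morphism `R_K → R_L` of group functors on commutative `ℚ`-algebras; by the Yoneda lemma
this is the same as a homomorphism of algebraic groups over `ℚ`. -/
structure ResHom (K L : Type u) [Field K] [Algebra ℚ K] [Field L] [Algebra ℚ L] where
  app : ∀ (A : Type u) [CommRing A] [Algebra ℚ A], ResPoints K A →* ResPoints L A
  naturality : ∀ (A B : Type u) [CommRing A] [Algebra ℚ A] [CommRing B] [Algebra ℚ B]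
    (f : A →ₐ[ℚ] B) (x : ResPoints K A),
    app B (ResPoints.map K f x) = ResPoints.map L f (app A x)

/-- A subgroup functor of `R_K`. -/
structure SubgroupFunctor (K : Type u) [Field K] [Algebra ℚ K] where
  points : ∀ (A : Type u) [CommRing A] [Algebra ℚ A], Subgroup (ResPoints K A)
  map_mem : ∀ (A B : Type u) [CommRing A] [Algebra ℚ A] [CommRing B] [Algebra ℚ B]
    (f : A →ₐ[ℚ] B) (x : ResPoints K A), x ∈ points A → ResPoints.map K f x ∈ points B

namespace SubgroupFunctor

variable {K : Type u} [Field K] [Algebra ℚ K]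

/-- Inclusion of subgroup functors. -/
def Le (H H' : SubgroupFunctor K) : Prop :=
  ∀ (A : Type u) [CommRing A] [Algebra ℚ A], H.points A ≤ H'.points A

/-- `H` is a closed subfunctor of `R_K`: for every `A`-point `x` of `R_K`, the locus in `Spec A`
where `x` lies in `H` is the closed subscheme defined by some ideal. -/
def IsClosed (H : SubgroupFunctor K) : Prop :=
  ∀ (A : Type u) [CommRing A] [Algebra ℚ A] (x : ResPoints K A),
    ∃ I : Ideal A, ∀ (B : Type u) [CommRing B] [Algebra ℚ B] (f : A →ₐ[ℚ] B),
      ResPoints.map K f x ∈ H.points B ↔ ∀ a ∈ I, f a = 0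

/-- `H` is (represented by) a connected scheme: there is a `ℚ`-algebra `B` with `Spec B` connected
and a universal point `b ∈ H(B)`, so that `H ≃ Spec B`. -/
def IsConnected (H : SubgroupFunctor K) : Prop :=
  ∃ (B : Type u) (_ : CommRing B) (_ : Algebra ℚ B) (b : ResPoints K B),
    b ∈ H.points B ∧
    (∀ (A : Type u) [CommRing A] [Algebra ℚ A] (x : ResPoints K A), x ∈ H.points A →
      ∃! f : B →ₐ[ℚ] A, ResPoints.map K f b = x) ∧
    ConnectedSpace (PrimeSpectrum B)

/-- The algebraic subgroup of `R_K` generated by two subgroup functors: the intersection of all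
closed subgroup functors containing both. -/
def generated (H₁ H₂ : SubgroupFunctor K) : SubgroupFunctor K where
  points A _ _ := ⨅ (H : SubgroupFunctor K) (_ : H.IsClosed ∧ H₁.Le H ∧ H₂.Le H), H.points A
  map_mem A B _ _ _ _ f x hx := by
    simp only [Subgroup.mem_iInf] at hx ⊢
    exact fun H hH => H.map_mem A B f x (hx H hH)

end SubgroupFunctor

/-- The scheme-theoretic kernel of a morphism `R_K → R_L`. -/
def ResHom.ker {K L : Type u} [Field K] [Algebra ℚ K] [Field L] [Algebra ℚ L]
    (r : ResHom K L) : SubgroupFunctor K where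
  points A _ _ := (r.app A).ker
  map_mem A B _ _ _ _ f x hx := by
    rw [MonoidHom.mem_ker] at hx ⊢
    rw [r.naturality, hx, map_one]

/-- The subgroup `𝔾_m ⊆ R_K`, with `Aˣ ⊆ (K ⊗ A)ˣ`. -/
noncomputable def scalars (K : Type u) [Field K] [Algebra ℚ K] : SubgroupFunctor K where
  points A _ _ :=
    (Units.map ((Algebra.TensorProduct.includeRight : A →ₐ[ℚ] K ⊗[ℚ] A) : A →* K ⊗[ℚ] A)).range
  map_mem A B _ _ _ _ f x hx := by
    obtain ⟨a, rfl⟩ := hx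
    refine ⟨Units.map (f : A →* B) a, ?_⟩
    ext
    simp [ResPoints.map]

end Functors

/-! ### Cocharacters -/

section Cocharacters

/-- A cocharacter of `R_K` over the field `Ω`: a morphism `𝔾_m → R_K` of group functors on
commutative `Ω`-algebras, that is, a homomorphism of algebraic groups over `Ω`. -/
@[ext]
structure Cocharacter (K Ω : Type u) [Field K] [Algebra ℚ K] [Field Ω] [Algebra ℚ Ω] where
  app : ∀ (A : Type u) [CommRing A] [Algebra ℚ A] [Algebra Ω A], Aˣ →* ResPoints K A
  naturality : ∀ (A B : Type u) [CommRing A] [Algebra ℚ A] [Algebra Ω A]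
    [CommRing B] [Algebra ℚ B] [Algebra Ω B] (f : A →ₐ[Ω] B) (t : Aˣ),
    app B (Units.map (f : A →* B) t) = ResPoints.map K (f.restrictScalars ℚ) (app A t)

variable {K L Ω : Type u} [Field K] [Algebra ℚ K] [Field L] [Algebra ℚ L] [Field Ω] [Algebra ℚ Ω]

/-- The group `X_*(R_K)` of cocharacters (written multiplicatively), with pointwise product. -/
noncomputable instance : CommGroup (Cocharacter K Ω) where
  mul a b := ⟨fun A _ _ _ => a.app A * b.app A, fun A B _ _ _ _ _ _ f t => by
    simp [a.naturality, b.naturality]⟩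
  one := ⟨fun A _ _ _ => 1, fun A B _ _ _ _ _ _ f t => by simp⟩
  inv a := ⟨fun A _ _ _ => (a.app A)⁻¹, fun A B _ _ _ _ _ _ f t => by simp [a.naturality]⟩
  mul_assoc a b c := Cocharacter.ext (by
    funext A _ _ _; exact mul_assoc (a.app A) (b.app A) (c.app A))
  one_mul a := Cocharacter.ext (by funext A _ _ _; exact one_mul (a.app A))
  mul_one a := Cocharacter.ext (by funext A _ _ _; exact mul_one (a.app A))
  inv_mul_cancel a := Cocharacter.ext (by funext A _ _ _; exact inv_mul_cancel (a.app A))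
  mul_comm a b := Cocharacter.ext (by funext A _ _ _; exact mul_comm (a.app A) (b.app A))

variable (Ω) in
/-- The homomorphism `X_*(r) : X_*(R_K) → X_*(R_L)`, `l ↦ r ∘ l`, induced by `r : R_K → R_L`. -/
noncomputable def ResHom.onCocharacters (r : ResHom K L) :
    Cocharacter K Ω →* Cocharacter L Ω where
  toFun l := ⟨fun A _ _ _ => (r.app A).comp (l.app A), fun A B _ _ _ _ _ _ f t => by
    simp [l.naturality, r.naturality]⟩
  map_one' := Cocharacter.ext (by
    funext A _ _ _; exact MonoidHom.comp_one (r.app A))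
  map_mul' a b := Cocharacter.ext (by
    funext A _ _ _; exact MonoidHom.comp_mul (r.app A) (a.app A) (b.app A))

variable (Ω) in
/-- The subgroup `X_*(H) ⊆ X_*(R_K)` of the cocharacters that factor through `H ⊆ R_K`. -/
def SubgroupFunctor.cocharacters (H : SubgroupFunctor K) : Subgroup (Cocharacter K Ω) where
  carrier := {l | ∀ (A : Type u) [CommRing A] [Algebra ℚ A] [Algebra Ω A] (t : Aˣ),
    l.app A t ∈ H.points A}
  mul_mem' ha hb A _ _ _ t := mul_mem (ha A t) (hb A t)
  one_mem' _ _ _ _ _ := one_mem _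
  inv_mem' ha A _ _ _ t := inv_mem (ha A t)

end Cocharacters

/-! ### The tori `U_E` and `GU_E` of a CM field -/

section CM

open NumberField

variable (E : Type u) [Field E] [NumberField E] [IsCMField E]

/-- The complex conjugation `ρ` of the CM field `E`, acting on `E ⊗ A` through `E`. -/
noncomputable def conjPoints (A : Type u) [CommRing A] [Algebra ℚ A] :
    E ⊗[ℚ] A →ₐ[ℚ] E ⊗[ℚ] A :=
  Algebra.TensorProduct.map
    ((IsCMField.complexConj E).restrictScalars ℚ : E →ₐ[ℚ] E) (AlgHom.id ℚ A)

/-- The unitary torus `U_E = {x ∈ R_E, x · x^ρ = 1}`. -/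
noncomputable def unitaryTorus : SubgroupFunctor E where
  points A _ _ := (MonoidHom.id (ResPoints E A) *
    Units.map (conjPoints E A : E ⊗[ℚ] A →* E ⊗[ℚ] A)).ker
  map_mem A B _ _ _ _ f x hx := by
    rw [MonoidHom.mem_ker] at hx ⊢
    have key : Units.map (conjPoints E B : E ⊗[ℚ] B →* E ⊗[ℚ] B) (ResPoints.map E f x) =
        ResPoints.map E f (Units.map (conjPoints E A : E ⊗[ℚ] A →* E ⊗[ℚ] A) x) := by
      have : (conjPoints E B).comp (Algebra.TensorProduct.map (AlgHom.id ℚ E) f) =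
          (Algebra.TensorProduct.map (AlgHom.id ℚ E) f).comp (conjPoints E A) := by
        ext <;> simp [conjPoints]
      ext
      exact DFunLike.congr_fun this (x : E ⊗[ℚ] A)
    rw [MonoidHom.mul_apply, MonoidHom.id_apply] at hx ⊢
    rw [key, ← map_mul, hx, map_one]

/-- The torus `GU_E ⊆ R_E`, generated by `U_E` and `𝔾_m`. -/
noncomputable def GU : SubgroupFunctor E :=
  SubgroupFunctor.generated (unitaryTorus E) (scalars E)

/-- A CM type on `E` with values in `Ec`: a set `S` of embeddings such that `Hom(E, Ec)` is the
disjoint union of `S` and of its complex conjugate `S^ρ = {φ ∘ ρ, φ ∈ S}`. -/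
def IsCMType {Ec : Type u} [Field Ec] [Algebra ℚ Ec] (S : Set (E →ₐ[ℚ] Ec)) : Prop :=
  S ∪ (fun φ => φ.comp ((IsCMField.complexConj E).restrictScalars ℚ : E →ₐ[ℚ] E)) '' S = Set.univ ∧
  Disjoint S ((fun φ => φ.comp ((IsCMField.complexConj E).restrictScalars ℚ : E →ₐ[ℚ] E)) '' S)

variable (Ec : Type u) [Field Ec] [Algebra ℚ Ec]

/-- The Galois closure `F^c` inside `E^c` of the maximal totally real subfield `F` of `E`. -/
def RealClosure : Type u :=
  ↥(IntermediateField.normalClosure ℚ (maximalRealSubfield E) Ec)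

noncomputable instance : Field (RealClosure E Ec) :=
  inferInstanceAs (Field ↥(IntermediateField.normalClosure ℚ (maximalRealSubfield E) Ec))

noncomputable instance : Algebra ℚ (RealClosure E Ec) :=
  (IntermediateField.normalClosure ℚ (maximalRealSubfield E) Ec).algebra'

noncomputable instance : Algebra (RealClosure E Ec) Ec :=
  inferInstanceAs (Algebra ↥(IntermediateField.normalClosure ℚ (maximalRealSubfield E) Ec) Ec)

lemma realClosure_normal (E : Type u) [Field E] [NumberField E] (Ec : Type u) [Field Ec]
    [Algebra ℚ Ec] [IsNormalClosure ℚ E Ec] : Normal ℚ (RealClosure E Ec) :=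
  haveI : Normal ℚ Ec := IsNormalClosure.normal (K := E)
  normalClosure.normal ℚ (maximalRealSubfield E) Ec

/-- The restriction map `Gal(E^c/ℚ) → Gal(F^c/ℚ)`. -/
noncomputable def restrictGal [IsNormalClosure ℚ E Ec] :
    (Ec ≃ₐ[ℚ] Ec) →* (RealClosure E Ec ≃ₐ[ℚ] RealClosure E Ec) :=
  haveI := realClosure_normal E Ec
  AlgEquiv.restrictNormalHom (RealClosure E Ec)

end CM

/-! ### The reflex field and the reciprocity morphism -/

section Reflex

variable {E Ec : Type u} [Field E] [Algebra ℚ E] [Field Ec] [Algebra ℚ Ec]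

/-- The subgroup of `Gal(E^c/ℚ)` stabilizing the set `S` of embeddings of `E`. -/
def stabilizer (S : Set (E →ₐ[ℚ] Ec)) : Subgroup (Ec ≃ₐ[ℚ] Ec) where
  carrier := {s | ∀ φ : E →ₐ[ℚ] Ec, (s : Ec →ₐ[ℚ] Ec).comp φ ∈ S ↔ φ ∈ S}
  mul_mem' {a b} ha hb φ := (ha ((b : Ec →ₐ[ℚ] Ec).comp φ)).trans (hb φ)
  one_mem' _ := Iff.rfl
  inv_mem' {a} ha φ := by
    rw [← ha]
    have : (a : Ec →ₐ[ℚ] Ec).comp (((a⁻¹ : Ec ≃ₐ[ℚ] Ec) : Ec →ₐ[ℚ] Ec).comp φ) = φ := by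
      ext x; exact a.apply_symm_apply (φ x)
    rw [this]

/-- The reflex field `E' ⊆ E^c` of `(E, S)`: the fixed field of the stabilizer of `S`. -/
def ReflexField (S : Set (E →ₐ[ℚ] Ec)) : Type u :=
  ↥(IntermediateField.fixedField (stabilizer S))

noncomputable instance (S : Set (E →ₐ[ℚ] Ec)) : Field (ReflexField S) :=
  inferInstanceAs (Field ↥(IntermediateField.fixedField (stabilizer S)))

noncomputable instance (S : Set (E →ₐ[ℚ] Ec)) : Algebra ℚ (ReflexField S) :=
  (IntermediateField.fixedField (stabilizer S)).algebra'

noncomputable instance (S : Set (E →ₐ[ℚ] Ec)) : Algebra (ReflexField S) Ec :=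
  inferInstanceAs (Algebra ↥(IntermediateField.fixedField (stabilizer S)) Ec)

/-- The `ℚ`-algebra map `E ⊗ M → Ec`, `x ⊗ y ↦ φ(x) y`, for a subfield `M` of `Ec`. -/
noncomputable def evalAt (M : Type u) [Field M] [Algebra ℚ M] [Algebra M Ec]
    (φ : E →ₐ[ℚ] Ec) : E ⊗[ℚ] M →ₐ[ℚ] Ec :=
  Algebra.TensorProduct.productMap φ (IsScalarTower.toAlgHom ℚ M Ec)

@[simp] lemma evalAt_tmul (M : Type u) [Field M] [Algebra ℚ M] [Algebra M Ec]
    (φ : E →ₐ[ℚ] Ec) (x : E) (y : M) :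
    evalAt M φ (x ⊗ₜ y) = φ x * algebraMap M Ec y := by
  simp [evalAt]

variable [FiniteDimensional ℚ E] [IsNormalClosure ℚ E Ec]

open Classical in
lemma exists_dual (E Ec : Type u) [Field E] [Algebra ℚ E] [Field Ec] [Algebra ℚ Ec]
    [FiniteDimensional ℚ E] [IsNormalClosure ℚ E Ec] :
    ∃ d : Fin (Module.finrank ℚ E) → (E →ₐ[ℚ] Ec) → Ec,
      (∀ φ ψ : E →ₐ[ℚ] Ec, ∑ j, φ (Module.finBasis ℚ E j) * d j ψ =
        if φ = ψ then 1 else 0) ∧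
      (∀ i j, ∑ φ : E →ₐ[ℚ] Ec, d i φ * φ (Module.finBasis ℚ E j) = if i = j then 1 else 0) := by
  classical
  let b := Module.finBasis ℚ E
  let P : Matrix (E →ₐ[ℚ] Ec) (Fin (Module.finrank ℚ E)) Ec := fun φ j => φ (b j)
  have hcard : Fintype.card (E →ₐ[ℚ] Ec) = Fintype.card (Fin (Module.finrank ℚ E)) := by
    rw [Fintype.card_fin]
    exact AlgHom.card_of_splits ℚ E Ec IsNormalClosure.splits
  have hP : LinearIndependent Ec P.row := by
    rw [Fintype.linearIndependent_iff]
    intro c hc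
    have h := Fintype.linearIndependent_iff.mp (linearIndependent_toLinearMap ℚ E Ec) c
    apply h
    refine b.ext fun j => ?_
    have := congrFun hc j
    simpa [P, Matrix.row] using this
  let e := Fintype.equivOfCardEq hcard
  have hu : IsUnit (P.submatrix id e) := by
    rw [← Matrix.linearIndependent_rows_iff_isUnit, Fintype.linearIndependent_iff]
    intro c hc
    refine Fintype.linearIndependent_iff.mp hP c ?_
    funext j
    have := congrFun hc (e.symm j)
    simpa using this
  obtain ⟨Q, hQ⟩ := hu.exists_right_inv
  refine ⟨fun j ψ => Q (e.symm j) ψ, fun φ ψ => ?_, fun i j => ?_⟩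
  · have := congrFun (congrFun hQ φ) ψ
    rw [Matrix.mul_apply] at this
    rw [← e.sum_comp]
    simpa [P, Matrix.one_apply, Matrix.submatrix] using this
  · have hQ' := mul_eq_one_comm.mp hQ
    have := congrFun (congrFun hQ' (e.symm i)) (e.symm j)
    rw [Matrix.mul_apply] at this
    simpa [P, Matrix.one_apply, Matrix.submatrix] using this

/-- Elements of `E ⊗ M` are determined by their images under all embeddings of `E`. -/
lemma evalAt_injective (M : Type u) [Field M] [Algebra ℚ M] [Algebra M Ec]
    {x y : E ⊗[ℚ] M}
    (h : ∀ φ : E →ₐ[ℚ] Ec, evalAt M φ x = evalAt M φ y) : x = y := by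
  classical
  obtain ⟨d, -, hd⟩ := exists_dual E Ec
  let b := Module.finBasis ℚ E
  suffices H : ∀ z : E ⊗[ℚ] M, (∀ φ : E →ₐ[ℚ] Ec, evalAt M φ z = 0) → z = 0 by
    refine sub_eq_zero.mp (H _ fun φ => ?_)
    rw [map_sub, h, sub_self]
  intro z hz
  obtain ⟨c, rfl⟩ : ∃ c : Fin (Module.finrank ℚ E) → M, z = ∑ j, b j ⊗ₜ c j := by
    clear hz
    induction z with
    | zero => exact ⟨0, by simp⟩
    | tmul x y =>
      refine ⟨fun j => b.repr x j • y, ?_⟩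
      conv_lhs => rw [← b.sum_repr x, TensorProduct.sum_tmul]
      simp [TensorProduct.smul_tmul]
    | add x y hx hy =>
      obtain ⟨c, rfl⟩ := hx
      obtain ⟨c', rfl⟩ := hy
      exact ⟨c + c', by simp [TensorProduct.tmul_add, Finset.sum_add_distrib]⟩
  have hc : ∀ j, algebraMap M Ec (c j) = 0 := by
    intro i
    have h1 : ∑ φ : E →ₐ[ℚ] Ec, d i φ * evalAt M φ (∑ j, b j ⊗ₜ c j) = algebraMap M Ec (c i) := by
      simp only [map_sum, evalAt_tmul, Finset.mul_sum]
      rw [Finset.sum_comm]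
      simp only [← mul_assoc, ← Finset.sum_mul, b, hd]
      simp
    rw [← h1]
    simp [hz]
  exact Finset.sum_eq_zero fun j _ => by
    rw [(map_eq_zero _).mp (hc j), TensorProduct.tmul_zero]

open Classical in
/-- There is an element of `E ⊗ E'` whose image under `x ⊗ y ↦ φ(x) y` is `1` for `φ ∈ S` and `0`
for `φ ∉ S`; by `evalAt_injective` it is unique. -/
lemma exists_idempotent (S : Set (E →ₐ[ℚ] Ec)) :
    ∃ e : E ⊗[ℚ] ReflexField S,
      ∀ φ : E →ₐ[ℚ] Ec, evalAt (ReflexField S) φ e = if φ ∈ S then 1 else 0 := by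
  obtain ⟨d, hd, hd'⟩ := exists_dual E Ec
  let b := Module.finBasis ℚ E
  let c : Fin (Module.finrank ℚ E) → Ec := fun j => ∑ ψ : E →ₐ[ℚ] Ec, if ψ ∈ S then d j ψ else 0
  have hc : ∀ φ : E →ₐ[ℚ] Ec, ∑ j, φ (b j) * c j = if φ ∈ S then 1 else 0 := by
    intro φ
    simp only [c, Finset.mul_sum, mul_ite, mul_zero]
    rw [Finset.sum_comm]
    have : ∀ ψ : E →ₐ[ℚ] Ec, (∑ j, if ψ ∈ S then φ (b j) * d j ψ else 0) =
        if φ = ψ then (if φ ∈ S then 1 else 0) else 0 := by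
      intro ψ
      by_cases hψ : ψ ∈ S
      · simp only [hψ, if_true, b, hd]
        by_cases h : φ = ψ
        · simp [h, hψ]
        · simp [h]
      · by_cases h : φ = ψ
        · simp [h, hψ]
        · simp [h, hψ]
    simp [this]
  have hmem : ∀ j, c j ∈ IntermediateField.fixedField (stabilizer S) := by
    intro i
    rw [IntermediateField.mem_fixedField_iff]
    intro s hs
    have h1 : ∀ a : Fin (Module.finrank ℚ E) → Ec,
        (∀ φ : E →ₐ[ℚ] Ec, ∑ j, φ (b j) * a j = if φ ∈ S then 1 else 0) →
        a i = ∑ φ : E →ₐ[ℚ] Ec, d i φ * if φ ∈ S then 1 else 0 := by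
      intro a ha
      simp only [← ha, Finset.mul_sum]
      rw [Finset.sum_comm]
      simp only [← mul_assoc, ← Finset.sum_mul, b, hd']
      simp
    have := h1 (fun j => s (c j)) (fun φ => ?_)
    · exact this.trans (h1 c hc).symm
    · have hφ := congrArg s (hc (((s⁻¹ : Ec ≃ₐ[ℚ] Ec) : Ec →ₐ[ℚ] Ec).comp φ))
      have hs' := (stabilizer S).inv_mem hs φ
      have hss : ∀ y, s (s⁻¹ y) = y := s.apply_symm_apply
      simpa [hs', apply_ite s, hss] using hφ
  refine ⟨∑ j, b j ⊗ₜ (show ReflexField S from ⟨c j, hmem j⟩), fun φ => ?_⟩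
  rw [map_sum, ← hc φ]
  exact Finset.sum_congr rfl fun j _ => evalAt_tmul _ _ _ _

/-- The idempotent of `E ⊗ E'` attached to `S`: under `E ⊗ Ec ≃ Ec^{Hom(E, Ec)}` it is the
indicator function of `S`. -/
noncomputable def typeIdempotent (S : Set (E →ₐ[ℚ] Ec)) : E ⊗[ℚ] ReflexField S :=
  (exists_idempotent S).choose

lemma typeIdempotent_mul_self (S : Set (E →ₐ[ℚ] Ec)) :
    typeIdempotent S * typeIdempotent S = typeIdempotent S := by
  classical
  refine evalAt_injective (Ec := Ec) (ReflexField S) fun φ => ?_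
  rw [map_mul, typeIdempotent, (exists_idempotent S).choose_spec φ]
  split_ifs <;> simp

/-- The cocharacter `μ` attached to `S` on points; it is defined over the reflex field `E'`: for an
`E'`-algebra `B`, it sends `t ∈ Bˣ` to the point of `R_E(B) = (E ⊗ B)ˣ` which is `t` on the
components indexed by `S` and `1` on the other ones. -/
noncomputable def muPoints (S : Set (E →ₐ[ℚ] Ec)) (B : Type u) [CommRing B] [Algebra ℚ B]
    [Algebra (ReflexField S) B] : Bˣ →* ResPoints E B :=
  Units.map
    { toFun := fun t =>
        Algebra.TensorProduct.map (AlgHom.id ℚ E) (IsScalarTower.toAlgHom ℚ (ReflexField S) B)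
          (typeIdempotent S) * ((1 : E) ⊗ₜ[ℚ] t) +
        (1 - Algebra.TensorProduct.map (AlgHom.id ℚ E)
          (IsScalarTower.toAlgHom ℚ (ReflexField S) B) (typeIdempotent S))
      map_one' := by
        rw [← Algebra.TensorProduct.one_def]; ring
      map_mul' := fun s t => by
        have h := congrArg (Algebra.TensorProduct.map (AlgHom.id ℚ E)
          (IsScalarTower.toAlgHom ℚ (ReflexField S) B)) (typeIdempotent_mul_self S)
        rw [map_mul] at h
        have hst : (1 : E) ⊗ₜ[ℚ] (s * t) = ((1 : E) ⊗ₜ[ℚ] s) * ((1 : E) ⊗ₜ[ℚ] t) := by simp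
        rw [hst]
        generalize Algebra.TensorProduct.map (AlgHom.id ℚ E)
          (IsScalarTower.toAlgHom ℚ (ReflexField S) B) (typeIdempotent S) = e at h ⊢
        linear_combination (1 - (1 : E) ⊗ₜ[ℚ] s - (1 : E) ⊗ₜ[ℚ] t +
          ((1 : E) ⊗ₜ[ℚ] s) * ((1 : E) ⊗ₜ[ℚ] t)) * (-h) }

lemma muPoints_naturality (S : Set (E →ₐ[ℚ] Ec)) {A B : Type u} [CommRing A] [Algebra ℚ A]
    [Algebra (ReflexField S) A] [CommRing B] [Algebra ℚ B] [Algebra (ReflexField S) B]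
    (f : A →ₐ[ReflexField S] B) (t : Aˣ) :
    muPoints S B (Units.map (f : A →* B) t) =
      ResPoints.map E (f.restrictScalars ℚ) (muPoints S A t) := by
  have key : Algebra.TensorProduct.map (AlgHom.id ℚ E)
      (IsScalarTower.toAlgHom ℚ (ReflexField S) B) =
      (Algebra.TensorProduct.map (AlgHom.id ℚ E) (f.restrictScalars ℚ)).comp
        (Algebra.TensorProduct.map (AlgHom.id ℚ E)
          (IsScalarTower.toAlgHom ℚ (ReflexField S) A)) := by
    ext x
    · simp
    · simp
  ext
  simp [muPoints, ResPoints.map, key]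

/-- The norm `N_{L/ℚ} : Res_{L/ℚ}(R_{K,L}) → R_K` on points: the norm
`(K ⊗ (L ⊗ A))ˣ ≃ ((K ⊗ A) ⊗ L)ˣ → (K ⊗ A)ˣ` of the finite free `(K ⊗ A)`-algebra
`(K ⊗ A) ⊗ L`. -/
noncomputable def normPoints (K L A : Type u) [Field K] [Algebra ℚ K] [Field L] [Algebra ℚ L]
    [CommRing A] [Algebra ℚ A] : ResPoints K (L ⊗[ℚ] A) →* ResPoints K A :=
  Units.map ((Algebra.norm (K ⊗[ℚ] A) : (K ⊗[ℚ] A) ⊗[ℚ] L →* K ⊗[ℚ] A).comp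
    (((Algebra.TensorProduct.assoc ℚ ℚ ℚ K A L).symm.toAlgHom.comp
      (Algebra.TensorProduct.map (AlgHom.id ℚ K) (Algebra.TensorProduct.comm ℚ L A).toAlgHom)) :
        K ⊗[ℚ] (L ⊗[ℚ] A) →* (K ⊗[ℚ] A) ⊗[ℚ] L))

lemma norm_map {C D L : Type u} [CommRing C] [Algebra ℚ C] [CommRing D] [Algebra ℚ D]
    [Field L] [Algebra ℚ L] [FiniteDimensional ℚ L] (f : C →ₐ[ℚ] D) (x : C ⊗[ℚ] L) :
    Algebra.norm D (Algebra.TensorProduct.map f (AlgHom.id ℚ L) x) =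
      f (Algebra.norm C x) := by
  classical
  let b := Module.finBasis ℚ L
  rw [Algebra.norm_eq_matrix_det (Algebra.TensorProduct.basis D b),
    Algebra.norm_eq_matrix_det (Algebra.TensorProduct.basis C b), AlgHom.map_det]
  congr 1
  induction x with
  | zero => simp
  | tmul c l =>
    ext i j
    have h : ∀ (A : Type u) [CommRing A] [Algebra ℚ A] (a : A),
        Algebra.leftMulMatrix (Algebra.TensorProduct.basis A b) (a ⊗ₜ[ℚ] l) i j =
          a * algebraMap ℚ A (b.repr (l * b j) i) := by
      intro A _ _ a
      rw [Algebra.leftMulMatrix_eq_repr_mul]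
      simp [Algebra.TensorProduct.basis_apply, Algebra.TensorProduct.basis_repr_tmul]
    simp [h]
  | add x y hx hy => simp only [map_add, hx, hy]

lemma normPoints_naturality {K L A B : Type u} [Field K] [Algebra ℚ K] [Field L] [Algebra ℚ L]
    [FiniteDimensional ℚ L] [CommRing A] [Algebra ℚ A] [CommRing B] [Algebra ℚ B]
    (f : A →ₐ[ℚ] B) (x : ResPoints K (L ⊗[ℚ] A)) :
    normPoints K L B (ResPoints.map K (Algebra.TensorProduct.map (AlgHom.id ℚ L) f) x) =
      ResPoints.map K f (normPoints K L A x) := by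
  have key : ((Algebra.TensorProduct.assoc ℚ ℚ ℚ K B L).symm.toAlgHom.comp
      (Algebra.TensorProduct.map (AlgHom.id ℚ K) (Algebra.TensorProduct.comm ℚ L B).toAlgHom)).comp
      (Algebra.TensorProduct.map (AlgHom.id ℚ K) (Algebra.TensorProduct.map (AlgHom.id ℚ L) f)) =
      (Algebra.TensorProduct.map (Algebra.TensorProduct.map (AlgHom.id ℚ K) f)
        (AlgHom.id ℚ L)).comp ((Algebra.TensorProduct.assoc ℚ ℚ ℚ K A L).symm.toAlgHom.comp
      (Algebra.TensorProduct.map (AlgHom.id ℚ K)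
        (Algebra.TensorProduct.comm ℚ L A).toAlgHom)) := by
    ext <;> simp [Algebra.TensorProduct.one_def]
  ext
  have h := DFunLike.congr_fun key (x : K ⊗[ℚ] (L ⊗[ℚ] A))
  exact (congrArg (Algebra.norm (K ⊗[ℚ] B)) h).trans (norm_map _ _)

lemma finiteDimensional_of_isNormalClosure (k K M : Type*) [Field k] [Field K] [Algebra k K]
    [Field M] [Algebra k M] [FiniteDimensional k K] [IsNormalClosure k K M] :
    FiniteDimensional k M := by
  have h : IntermediateField.normalClosure k K M = ⊤ :=
    (Algebra.IsAlgebraic.isNormalClosure_iff.mp inferInstance).2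
  have h1 := normalClosure.is_finiteDimensional k K M
  rw [h] at h1
  exact (IntermediateField.topEquiv (F := k) (E := M)).toLinearEquiv.finiteDimensional

lemma finiteDimensional_reflexField (S : Set (E →ₐ[ℚ] Ec)) :
    FiniteDimensional ℚ (ReflexField S) :=
  haveI : FiniteDimensional ℚ Ec := finiteDimensional_of_isNormalClosure ℚ E Ec
  FiniteDimensional.of_injective
    (IsScalarTower.toAlgHom ℚ (ReflexField S) Ec).toLinearMap
    (algebraMap (ReflexField S) Ec).injective

/-- The reciprocity morphism `r = N_{E'/ℚ} ∘ Res_{E'/ℚ}(μ) : R_{E'} → R_E`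
of `(E, S)`, where `E'` is the reflex field. -/
noncomputable def reciprocity (S : Set (E →ₐ[ℚ] Ec)) : ResHom (ReflexField S) E where
  app A _ _ := (normPoints E (ReflexField S) A).comp (muPoints S (ReflexField S ⊗[ℚ] A))
  naturality A B _ _ _ _ f x := by
    have := finiteDimensional_reflexField S
    have h := muPoints_naturality S (A := ReflexField S ⊗[ℚ] A) (B := ReflexField S ⊗[ℚ] B)
      (Algebra.TensorProduct.map (AlgHom.id (ReflexField S) (ReflexField S)) f) x
    rw [MonoidHom.comp_apply, MonoidHom.comp_apply, ← normPoints_naturality]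
    exact congrArg (normPoints E (ReflexField S) B) h

/-- The lattice `L_μ = X_*(r)(X_*(R_{E'})) ⊆ X_*(R_E)`, the image of the reciprocity morphism on
cocharacters over `Ω`. -/
noncomputable def Lmu (S : Set (E →ₐ[ℚ] Ec)) (Ω : Type u) [Field Ω] [Algebra ℚ Ω] :
    Subgroup (Cocharacter E Ω) :=
  ((reciprocity S).onCocharacters Ω).range

end Reflex

end CMTorus

open CMTorus

/-!
# The reciprocity morphism of a CM type with the largest possible Galois group

Over an algebraically closed field `Ω`, the torus `R_K` splits as a power of `𝔾_m` indexed by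
`Hom(K, Ω)`, so its points are families of units and its cocharacters are integral functions on
`Hom(K, Ω)` (`Cocharacter.exists_exponents`; the units of `Ω[T, T⁻¹]` are the monomials).
In these coordinates, the reciprocity morphism is `r(x)_φ = ∏ x_ψ`, the product over the embeddings
`ψ` of the reflex field for which `φ ∈ T_ψ` (`unitComponent_reciprocity`). Here `T_ψ = β ∘ S` for any
extension `β` of `ψ` to `Ec`, and every `T_ψ` is a CM type.

The hypothesis says that `Gal(Ec/Fc)` has `2 ^ g` elements. It acts on the `g` pairs of conjugate
embeddings of `E` by exchanging the members of some of the pairs, and it acts faithfully, so all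
`2 ^ g` patterns of exchanges occur (`exists_galois_comp_mem_iff`). Hence `T_ψ` runs through *all* CM
types (`exists_translate_eq`), and both assertions become statements on CM types.

* The indicator functions of all CM types span the lattice of functions `f` with `f(φ) + f(φρ)`
  constant (`mem_range_spanHom`). This lattice is `X_*(GU_E)`, because the points of `GU_E` are
  the `x` for which `x · x^ρ` is a scalar (`mem_GU_iff`): that condition is closed, and after
  adjoining a square root of the scalar, `x` becomes the product of a scalar and a point of `U_E`.
* The kernel of `r` over `Ω` is diagonalizable, and its character group is the cokernel of
  `[φ] ↦ ∑_{T_ψ ∋ φ} e_ψ`. This cokernel is torsion-free (`mem_range_cospanHom_of_smul`), so its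
  group ring over `Ω` is a domain. The coordinate ring of `ker r` over `ℚ` embeds into that domain
  (`SubgroupFunctor.IsClosed.isConnected_of_isDomain`), hence its spectrum is connected.
-/

namespace CMTorus

/-! ### Points of `R_K` over an algebraically closed field -/

section Split

variable {K Ω : Type u} [Field K] [Algebra ℚ K] [Field Ω] [Algebra ℚ Ω]

/-- The component at `φ : K → Ω` of the splitting `K ⊗ A ≃ A^{Hom(K, Ω)}`, for an `Ω`-algebra `A`:
it sends `x ⊗ a` to `φ(x) a`. -/
noncomputable def component (A : Type u) [CommRing A] [Algebra ℚ A] [Algebra Ω A]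
    (φ : K →ₐ[ℚ] Ω) : K ⊗[ℚ] A →ₐ[ℚ] A :=
  Algebra.TensorProduct.productMap ((IsScalarTower.toAlgHom ℚ Ω A).comp φ) (AlgHom.id ℚ A)

@[simp] lemma component_tmul (A : Type u) [CommRing A] [Algebra ℚ A] [Algebra Ω A]
    (φ : K →ₐ[ℚ] Ω) (x : K) (a : A) :
    component A φ (x ⊗ₜ a) = algebraMap Ω A (φ x) * a := by
  simp [component]

/-- The component at `φ` of a point of `R_K`. -/
noncomputable def unitComponent (A : Type u) [CommRing A] [Algebra ℚ A] [Algebra Ω A]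
    (φ : K →ₐ[ℚ] Ω) : ResPoints K A →* Aˣ :=
  Units.map (component A φ : K ⊗[ℚ] A →* A)

@[simp] lemma coe_unitComponent (A : Type u) [CommRing A] [Algebra ℚ A] [Algebra Ω A]
    (φ : K →ₐ[ℚ] Ω) (x : ResPoints K A) :
    (unitComponent A φ x : A) = component A φ (x : K ⊗[ℚ] A) := rfl

lemma component_map {A B : Type u} [CommRing A] [Algebra ℚ A] [Algebra Ω A]
    [CommRing B] [Algebra ℚ B] [Algebra Ω B] (f : A →ₐ[Ω] B) (φ : K →ₐ[ℚ] Ω) (x : K ⊗[ℚ] A) :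
    component B φ (Algebra.TensorProduct.map (AlgHom.id ℚ K) (f.restrictScalars ℚ) x) =
      f (component A φ x) := by
  have : (component B φ).comp
      (Algebra.TensorProduct.map (AlgHom.id ℚ K) (f.restrictScalars ℚ)) =
      (f.restrictScalars ℚ).comp (component A φ) := by
    ext <;> simp
  exact DFunLike.congr_fun this x

lemma unitComponent_map {A B : Type u} [CommRing A] [Algebra ℚ A] [Algebra Ω A]
    [CommRing B] [Algebra ℚ B] [Algebra Ω B] (f : A →ₐ[Ω] B) (φ : K →ₐ[ℚ] Ω)
    (x : ResPoints K A) :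
    unitComponent B φ (ResPoints.map K (f.restrictScalars ℚ) x) =
      Units.map (f : A →* B) (unitComponent A φ x) :=
  Units.ext (component_map f φ (x : K ⊗[ℚ] A))

lemma exists_eq_sum_tmul {J : Type*} [Fintype J] (b : Module.Basis J ℚ K)
    {A : Type u} [CommRing A] [Algebra ℚ A] (z : K ⊗[ℚ] A) :
    ∃ c : J → A, z = ∑ j, b j ⊗ₜ c j := by
  induction z with
  | zero => exact ⟨0, by simp⟩
  | tmul x y =>
    refine ⟨fun j => b.repr x j • y, ?_⟩
    conv_lhs => rw [← b.sum_repr x, TensorProduct.sum_tmul]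
    simp [TensorProduct.smul_tmul]
  | add x y hx hy =>
    obtain ⟨c, rfl⟩ := hx
    obtain ⟨c', rfl⟩ := hy
    exact ⟨c + c', by simp [TensorProduct.tmul_add, Finset.sum_add_distrib]⟩

open Classical in
/-- The matrix of all embeddings `K → Ω` on a basis of `K` is invertible. -/
lemma exists_dual_of_isAlgClosed (K Ω : Type u) [Field K] [Algebra ℚ K] [FiniteDimensional ℚ K]
    [Field Ω] [Algebra ℚ Ω] [IsAlgClosed Ω] :
    ∃ d : Fin (Module.finrank ℚ K) → (K →ₐ[ℚ] Ω) → Ω,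
      (∀ φ ψ : K →ₐ[ℚ] Ω, ∑ j, φ (Module.finBasis ℚ K j) * d j ψ = if φ = ψ then 1 else 0) ∧
      (∀ i j, ∑ φ : K →ₐ[ℚ] Ω, d i φ * φ (Module.finBasis ℚ K j) = if i = j then 1 else 0) := by
  let b := Module.finBasis ℚ K
  let P : Matrix (K →ₐ[ℚ] Ω) (Fin (Module.finrank ℚ K)) Ω := fun φ j => φ (b j)
  let e : Fin (Module.finrank ℚ K) ≃ (K →ₐ[ℚ] Ω) :=
    Fintype.equivOfCardEq (by rw [Fintype.card_fin, AlgHom.card])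
  have hu : IsUnit (P.submatrix e id) := by
    rw [← Matrix.linearIndependent_rows_iff_isUnit]
    have : LinearIndependent Ω P.row := by
      rw [Fintype.linearIndependent_iff]
      intro c hc
      refine Fintype.linearIndependent_iff.mp (linearIndependent_toLinearMap ℚ K Ω) c ?_
      refine b.ext fun j => ?_
      simpa [P, Matrix.row] using congrFun hc j
    exact this.comp e e.injective
  obtain ⟨Q, hQ⟩ := hu.exists_right_inv
  refine ⟨fun j ψ => Q j (e.symm ψ), fun φ ψ => ?_, fun i j => ?_⟩
  · have := congrFun (congrFun hQ (e.symm φ)) (e.symm ψ)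
    simpa [P, Matrix.mul_apply, Matrix.one_apply, Matrix.submatrix] using this
  · have hQ' := mul_eq_one_comm.mp hQ
    have := congrFun (congrFun hQ' i) j
    rw [Matrix.mul_apply] at this
    rw [← e.sum_comp]
    simpa [P, Matrix.one_apply, Matrix.submatrix] using this

variable [FiniteDimensional ℚ K] [IsAlgClosed Ω]

lemma component_bijective (A : Type u) [CommRing A] [Algebra ℚ A] [Algebra Ω A] :
    Function.Bijective fun (z : K ⊗[ℚ] A) (φ : K →ₐ[ℚ] Ω) => component A φ z := by
  classical
  obtain ⟨d, hd, hd'⟩ := exists_dual_of_isAlgClosed K Ω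
  let b := Module.finBasis ℚ K
  constructor
  · intro x y hxy
    obtain ⟨c, hc⟩ := exists_eq_sum_tmul b (x - y)
    have h0 : ∀ φ : K →ₐ[ℚ] Ω, component A φ (x - y) = 0 := fun φ => by
      rw [map_sub, sub_eq_zero]
      exact congrFun hxy φ
    rw [← sub_eq_zero, hc]
    refine Finset.sum_eq_zero fun i _ => ?_
    have h1 : ∑ φ : K →ₐ[ℚ] Ω, algebraMap Ω A (d i φ) * component A φ (x - y) = c i := by
      simp only [hc, map_sum, component_tmul, Finset.mul_sum, ← mul_assoc, ← map_mul]
      rw [Finset.sum_comm]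
      simp only [← Finset.sum_mul, ← map_sum, b, hd']
      simp
    rw [← h1]
    simp [h0]
  · intro y
    refine ⟨∑ j, b j ⊗ₜ ∑ ψ : K →ₐ[ℚ] Ω, algebraMap Ω A (d j ψ) * y ψ, ?_⟩
    funext φ
    simp only [map_sum, component_tmul, Finset.mul_sum, ← mul_assoc, ← map_mul]
    rw [Finset.sum_comm]
    simp only [← Finset.sum_mul, ← map_sum, b, hd]
    simp

lemma unitComponent_injective {A : Type u} [CommRing A] [Algebra ℚ A] [Algebra Ω A]
    {x y : ResPoints K A} (h : ∀ φ : K →ₐ[ℚ] Ω, unitComponent A φ x = unitComponent A φ y) :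
    x = y :=
  Units.ext <| (component_bijective (Ω := Ω) A).1 <|
    funext fun φ => congrArg Units.val (h φ)

/-- A point of `R_K` over an `Ω`-algebra may be prescribed by its components. -/
lemma exists_unitComponent_eq {A : Type u} [CommRing A] [Algebra ℚ A] [Algebra Ω A]
    (y : (K →ₐ[ℚ] Ω) → Aˣ) : ∃ x : ResPoints K A, ∀ φ, unitComponent A φ x = y φ := by
  obtain ⟨x, hx⟩ := (component_bijective (K := K) (Ω := Ω) A).2 fun φ => y φ
  obtain ⟨x', hx'⟩ := (component_bijective (K := K) (Ω := Ω) A).2 fun φ => ↑(y φ)⁻¹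
  have h : x * x' = 1 := (component_bijective (Ω := Ω) A).1 <| funext fun φ => by
    have h1 := congrFun hx φ
    have h2 := congrFun hx' φ
    simp only at h1 h2
    simp [h1, h2]
  exact ⟨⟨x, x', h, by rw [mul_comm, h]⟩, fun φ => Units.ext (congrFun hx φ)⟩

/-- Over an `Ω`-algebra `A`, the norm of `A ⊗ K` is the product of all components. -/
lemma norm_eq_prod_component {A : Type u} [CommRing A] [Algebra ℚ A] [Algebra Ω A]
    (w : A ⊗[ℚ] K) :
    Algebra.norm A w =
      ∏ φ : K →ₐ[ℚ] Ω, component A φ (Algebra.TensorProduct.comm ℚ A K w) := by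
  classical
  let F : A ⊗[ℚ] K →ₐ[A] ((K →ₐ[ℚ] Ω) → A) := AlgHom.pi fun φ =>
    Algebra.TensorProduct.lift (Algebra.ofId A A) ((IsScalarTower.toAlgHom ℚ Ω A).comp φ)
      fun _ _ => Commute.all _ _
  have hF : ∀ z φ, F z φ = component A φ (Algebra.TensorProduct.comm ℚ A K z) := by
    intro z φ
    induction z with
    | zero => simp
    | tmul x y => simp [F, mul_comm]
    | add x y hx hy => simp [hx, hy]
  have hbij : Function.Bijective F := by
    have := (component_bijective (K := K) (Ω := Ω) A).comp
      (Algebra.TensorProduct.comm ℚ A K).bijective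
    convert this using 1
    funext z φ
    exact hF z φ
  rw [← Algebra.norm_eq_of_algEquiv (AlgEquiv.ofBijective F hbij),
    Algebra.norm_eq_matrix_det (Pi.basisFun A (K →ₐ[ℚ] Ω))]
  have : Algebra.leftMulMatrix (Pi.basisFun A (K →ₐ[ℚ] Ω)) (F w) = Matrix.diagonal (F w) := by
    ext i j
    rw [Algebra.leftMulMatrix_eq_repr_mul]
    simp [Matrix.diagonal_apply, Pi.single_apply]
  rw [AlgEquiv.coe_ofBijective, this, Matrix.det_diagonal]
  simp [hF]

end Split

/-! ### Cocharacters as integral functions on embeddings -/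

section Exponents

open LaurentPolynomial in
/-- The units of the ring of Laurent polynomials over a field are the monomials. -/
lemma exists_eq_C_mul_T {k : Type*} [Field k] (w : (k[T;T⁻¹])ˣ) :
    ∃ (c : k) (n : ℤ), (w : k[T;T⁻¹]) = C c * T n := by
  obtain ⟨m, p, hp⟩ := exists_T_pow (w : k[T;T⁻¹])
  obtain ⟨m', q, hq⟩ := exists_T_pow ((w⁻¹ : (k[T;T⁻¹])ˣ) : k[T;T⁻¹])
  have hpq : p * q = Polynomial.X ^ (m + m') := by
    apply Polynomial.toLaurent_injective
    rw [map_mul, hp, hq, Polynomial.toLaurent_X_pow]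
    calc _ = ((w : k[T;T⁻¹]) * ((w⁻¹ : (k[T;T⁻¹])ˣ) : k[T;T⁻¹])) * (T m * T m') := by ring
      _ = _ := by rw [Units.mul_inv, one_mul, ← T_add, Nat.cast_add]
  obtain ⟨i, -, hi⟩ := (dvd_prime_pow Polynomial.prime_X _).1 (Dvd.intro q hpq)
  obtain ⟨v, hv⟩ := hi.symm
  obtain ⟨c, -, hc⟩ := Polynomial.isUnit_iff.1 v.isUnit
  refine ⟨c, i - m, ?_⟩
  have : (w : k[T;T⁻¹]) = Polynomial.toLaurent p * T (-m) := by
    rw [hp, mul_assoc, ← T_add, add_neg_cancel, T_zero, mul_one]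
  rw [this, ← hv, ← hc, map_mul, Polynomial.toLaurent_X_pow, Polynomial.toLaurent_C,
    mul_comm (T _) (C c), mul_assoc, ← T_add, sub_eq_add_neg]

variable {Ω : Type u} [Field Ω]

/-- The variable `T` as a unit of the ring of Laurent polynomials, that is, the universal point
of `𝔾_m`. -/
noncomputable def unitT (Ω : Type u) [Field Ω] : (LaurentPolynomial Ω)ˣ :=
  ⟨.T 1, .T (-1), by rw [← LaurentPolynomial.T_add]; simp,
    by rw [← LaurentPolynomial.T_add]; simp⟩

lemma unitT_zpow (n : ℤ) : ((unitT Ω ^ n : (LaurentPolynomial Ω)ˣ) : LaurentPolynomial Ω) =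
    .T n := by
  obtain ⟨m, rfl | rfl⟩ := n.eq_nat_or_neg
  · simp [unitT, LaurentPolynomial.T_pow]
  · rw [zpow_neg, ← inv_zpow, zpow_natCast]
    simp [unitT, LaurentPolynomial.T_pow]

lemma unitT_zpow_injective : Function.Injective fun n : ℤ => unitT Ω ^ n := by
  intro m n h
  have h' := congrArg Units.val h
  simp only [unitT_zpow] at h'
  exact AddMonoidAlgebra.single_left_injective one_ne_zero h'

/-- The morphism `Ω[T, T⁻¹] → A` attached to a point of `𝔾_m`. -/
noncomputable def specialize {A : Type u} [CommRing A] [Algebra Ω A] (t : Aˣ) :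
    LaurentPolynomial Ω →ₐ[Ω] A :=
  AddMonoidAlgebra.lift Ω A ℤ ((Units.coeHom A).comp (zpowersHom Aˣ t))

lemma specialize_T {A : Type u} [CommRing A] [Algebra Ω A] (t : Aˣ) (n : ℤ) :
    specialize (Ω := Ω) t (.T n) = ((t ^ n : Aˣ) : A) := by
  rw [specialize, LaurentPolynomial.T, AddMonoidAlgebra.lift_single]
  simp

lemma map_specialize_unitT {A : Type u} [CommRing A] [Algebra Ω A] (t : Aˣ) :
    Units.map (specialize (Ω := Ω) t : LaurentPolynomial Ω →* A) (unitT Ω) = t :=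
  Units.ext ((specialize_T t 1).trans (by simp))

variable {K : Type u} [Field K] [Algebra ℚ K] [Algebra ℚ Ω]

/-- Every cocharacter of `R_K` over `Ω` is given by powers `t ↦ t ^ f φ` in the components `φ`. -/
theorem Cocharacter.exists_exponents (l : Cocharacter K Ω) :
    ∃ f : (K →ₐ[ℚ] Ω) → ℤ, ∀ (A : Type u) [CommRing A] [Algebra ℚ A] [Algebra Ω A] (t : Aˣ)
      (φ : K →ₐ[ℚ] Ω), unitComponent A φ (l.app A t) = t ^ f φ := by
  choose c f hf using fun φ : K →ₐ[ℚ] Ω => exists_eq_C_mul_T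
    (unitComponent (LaurentPolynomial Ω) φ (l.app (LaurentPolynomial Ω) (unitT Ω)))
  have key : ∀ (A : Type u) [CommRing A] [Algebra ℚ A] [Algebra Ω A] (t : Aˣ)
      (φ : K →ₐ[ℚ] Ω), (unitComponent A φ (l.app A t) : A) =
        algebraMap Ω A (c φ) * ((t ^ f φ : Aˣ) : A) := by
    intro A _ _ _ t φ
    conv_lhs => rw [← map_specialize_unitT (Ω := Ω) t, l.naturality (LaurentPolynomial Ω) A, unitComponent_map]
    rw [Units.coe_map, hf]
    refine (map_mul (specialize (Ω := Ω) t) _ _).trans ?_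
    rw [specialize_T]
    exact congrArg (· * _) ((specialize t).commutes (c φ))
  have hc : ∀ φ, c φ = 1 := fun φ => by
    have := key Ω 1 φ
    simpa using this.symm
  refine ⟨f, fun A _ _ _ t φ => Units.ext ?_⟩
  rw [key, hc, map_one, one_mul]

variable [FiniteDimensional ℚ K] [IsAlgClosed Ω]

lemma Cocharacter.exists_of_exponents (f : (K →ₐ[ℚ] Ω) → ℤ) :
    ∃ l : Cocharacter K Ω, ∀ (A : Type u) [CommRing A] [Algebra ℚ A] [Algebra Ω A] (t : Aˣ)
      (φ : K →ₐ[ℚ] Ω), unitComponent A φ (l.app A t) = t ^ f φ := by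
  choose p hp using fun (A : Type u) (_ : CommRing A) (_ : Algebra ℚ A) (_ : Algebra Ω A)
    (t : Aˣ) => exists_unitComponent_eq (K := K) (A := A) (Ω := Ω) fun φ => t ^ f φ
  let m (A : Type u) [CommRing A] [Algebra ℚ A] [Algebra Ω A] : Aˣ →* ResPoints K A :=
    MonoidHom.mk' (p A ‹_› ‹_› ‹_›) fun s t =>
      unitComponent_injective (Ω := Ω) fun φ => by simp [hp, mul_zpow]
  have hm (A : Type u) [CommRing A] [Algebra ℚ A] [Algebra Ω A] (t : Aˣ) (φ : K →ₐ[ℚ] Ω) :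
      unitComponent A φ (m A t) = t ^ f φ := hp A _ _ _ t φ
  clear_value m
  refine ⟨⟨fun A _ _ _ => m A, fun A B _ _ _ _ _ _ g t => ?_⟩, fun A _ _ _ t φ => hm A t φ⟩
  refine unitComponent_injective (Ω := Ω) fun φ => ?_
  rw [unitComponent_map, hm, hm, map_zpow]

end Exponents

/-! ### The reciprocity morphism in components -/

section Reciprocity

variable {E Ec Ω : Type u} [Field E] [Algebra ℚ E] [Field Ec] [Algebra ℚ Ec]
  [FiniteDimensional ℚ E] [IsNormalClosure ℚ E Ec] [Field Ω] [Algebra ℚ Ω]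

/-- The translate `β ∘ S ⊆ Hom(E, Ω)` of `S`, for an embedding `ψ` of the reflex field and any
embedding `β` of `Ec` extending `ψ`. It is expressed through the idempotent of `S`, so that no `β`
has to be chosen. -/
def translate (S : Set (E →ₐ[ℚ] Ec)) (ψ : ReflexField S →ₐ[ℚ] Ω) : Set (E →ₐ[ℚ] Ω) :=
  {φ | Algebra.TensorProduct.productMap φ ψ (typeIdempotent S) = 1}

lemma mem_translate {S : Set (E →ₐ[ℚ] Ec)} {ψ : ReflexField S →ₐ[ℚ] Ω} {φ : E →ₐ[ℚ] Ω} :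
    φ ∈ translate S ψ ↔
      Algebra.TensorProduct.productMap φ ψ (typeIdempotent S) = 1 := Iff.rfl

lemma productMap_of_notMem_translate {S : Set (E →ₐ[ℚ] Ec)} {ψ : ReflexField S →ₐ[ℚ] Ω}
    {φ : E →ₐ[ℚ] Ω} (h : φ ∉ translate S ψ) :
    Algebra.TensorProduct.productMap φ ψ (typeIdempotent S) = 0 := by
  have := congrArg (Algebra.TensorProduct.productMap φ ψ) (typeIdempotent_mul_self S)
  rw [map_mul] at this
  exact (IsIdempotentElem.iff_eq_zero_or_one.1 this).resolve_right h

open Classical in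
/-- The component at `φ` of the reciprocity morphism is `x ↦ ∏ x_ψ`, the product over those `ψ` for
which `φ` lies in the translate of `S` by `ψ`. The factors come from the splitting of the norm of
`A ⊗ E'` over `A`, and the idempotent of `S` becomes `0` or `1` in each of them. -/
theorem unitComponent_reciprocity [IsAlgClosed Ω] (S : Set (E →ₐ[ℚ] Ec)) {A : Type u}
    [CommRing A] [Algebra ℚ A] [Algebra Ω A] (x : ResPoints (ReflexField S) A) (φ : E →ₐ[ℚ] Ω) :
    haveI := finiteDimensional_reflexField S
    unitComponent A φ ((reciprocity S).app A x) =
      ∏ ψ : ReflexField S →ₐ[ℚ] Ω, if φ ∈ translate S ψ then unitComponent A ψ x else 1 := by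
  have := finiteDimensional_reflexField S
  ext
  -- the component of `E ⊗ (E' ⊗ A)` at the pair `(φ, ψ)`
  let χ (ψ : ReflexField S →ₐ[ℚ] Ω) : E ⊗[ℚ] (ReflexField S ⊗[ℚ] A) →ₐ[ℚ] A :=
    Algebra.TensorProduct.productMap ((IsScalarTower.toAlgHom ℚ Ω A).comp φ) (component A ψ)
  have h1 : ∀ z : E ⊗[ℚ] (ReflexField S ⊗[ℚ] A),
      component A φ (Algebra.norm (E ⊗[ℚ] A)
        ((Algebra.TensorProduct.assoc ℚ ℚ ℚ E A (ReflexField S)).symm.toAlgHom.comp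
          (Algebra.TensorProduct.map (AlgHom.id ℚ E)
            (Algebra.TensorProduct.comm ℚ (ReflexField S) A).toAlgHom) z)) = ∏ ψ, χ ψ z := by
    intro z
    rw [← norm_map, norm_eq_prod_component (Ω := Ω)]
    refine Finset.prod_congr rfl fun ψ _ => ?_
    have : (((component A ψ).comp (Algebra.TensorProduct.comm ℚ A (ReflexField S)).toAlgHom).comp
      (Algebra.TensorProduct.map (component A φ) (AlgHom.id ℚ (ReflexField S)))).comp
      ((Algebra.TensorProduct.assoc ℚ ℚ ℚ E A (ReflexField S)).symm.toAlgHom.comp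
          (Algebra.TensorProduct.map (AlgHom.id ℚ E)
            (Algebra.TensorProduct.comm ℚ (ReflexField S) A).toAlgHom)) = χ ψ := by
      ext <;> simp [χ, Algebra.TensorProduct.one_def]
    exact DFunLike.congr_fun this z
  have h2 : ∀ ψ, (χ ψ).comp (Algebra.TensorProduct.map (AlgHom.id ℚ E)
      (IsScalarTower.toAlgHom ℚ (ReflexField S) (ReflexField S ⊗[ℚ] A))) =
      (IsScalarTower.toAlgHom ℚ Ω A).comp (Algebra.TensorProduct.productMap φ ψ) := by
    intro ψ
    ext <;> simp [χ]
  refine (h1 _).trans ?_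
  rw [Units.coe_prod]
  refine Finset.prod_congr rfl fun ψ _ => ?_
  have h3 := DFunLike.congr_fun (h2 ψ) (typeIdempotent S)
  simp only [AlgHom.comp_apply] at h3
  simp only [muPoints, Units.coe_map, MonoidHom.coe_mk, OneHom.coe_mk, map_add, map_mul, map_sub,
    map_one]
  erw [h3]
  split_ifs with h
  · rw [mem_translate.1 h]
    simp [χ]
  · rw [productMap_of_notMem_translate h]
    simp

end Reciprocity

/-! ### Closed subgroup functors and representability -/

section Closed

variable {K : Type u} [Field K] [Algebra ℚ K]

@[simp] lemma coe_resPointsMap {A B : Type u} [CommRing A] [Algebra ℚ A] [CommRing B]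
    [Algebra ℚ B] (f : A →ₐ[ℚ] B) (x : ResPoints K A) :
    (ResPoints.map K f x : K ⊗[ℚ] B) = Algebra.TensorProduct.map (AlgHom.id ℚ K) f x := rfl

lemma ResPoints.map_id {A : Type u} [CommRing A] [Algebra ℚ A] (x : ResPoints K A) :
    ResPoints.map K (AlgHom.id ℚ A) x = x := by
  ext
  simp

lemma ResPoints.map_comp {A B C : Type u} [CommRing A] [Algebra ℚ A] [CommRing B] [Algebra ℚ B]
    [CommRing C] [Algebra ℚ C] (g : B →ₐ[ℚ] C) (f : A →ₐ[ℚ] B) (x : ResPoints K A) :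
    ResPoints.map K (g.comp f) x = ResPoints.map K g (ResPoints.map K f x) := by
  have : Algebra.TensorProduct.map (AlgHom.id ℚ K) (g.comp f) =
      (Algebra.TensorProduct.map (AlgHom.id ℚ K) g).comp
        (Algebra.TensorProduct.map (AlgHom.id ℚ K) f) := by
    ext <;> simp
  exact Units.ext (DFunLike.congr_fun this (x : K ⊗[ℚ] A))

lemma sum_tmul_eq_zero_iff {J : Type*} [Fintype J] (b : Module.Basis J ℚ K)
    {A : Type u} [CommRing A] [Algebra ℚ A] (c : J → A) :
    ∑ j, b j ⊗ₜ[ℚ] c j = 0 ↔ c = 0 := by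
  refine ⟨fun h => ?_, fun h => by simp [h]⟩
  have := TensorProduct.sum_tmul_basis_left_eq_zero (M := K) b (Finsupp.equivFunOnFinite.symm c)
    (by rw [Finsupp.sum_fintype _ _ (by simp)]; simpa using h)
  funext j
  exact DFunLike.congr_fun this j

variable [FiniteDimensional ℚ K]

/-- The vanishing locus in `Spec A` of an element of `K ⊗ A` is closed. -/
lemma exists_ideal_map_eq_zero_iff {A : Type u} [CommRing A] [Algebra ℚ A] (z : K ⊗[ℚ] A) :
    ∃ I : Ideal A, ∀ (B : Type u) [CommRing B] [Algebra ℚ B] (f : A →ₐ[ℚ] B),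
      Algebra.TensorProduct.map (AlgHom.id ℚ K) f z = 0 ↔ ∀ a ∈ I, f a = 0 := by
  let b := Module.finBasis ℚ K
  obtain ⟨c, rfl⟩ := exists_eq_sum_tmul b z
  refine ⟨Ideal.span (Set.range c), fun B _ _ f => ?_⟩
  have h1 : Algebra.TensorProduct.map (AlgHom.id ℚ K) f (∑ j, b j ⊗ₜ c j) =
      ∑ j, b j ⊗ₜ f (c j) := by simp
  rw [h1, sum_tmul_eq_zero_iff]
  constructor
  · intro h
    have : Ideal.span (Set.range c) ≤ RingHom.ker (f : A →+* B) := by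
      rw [Ideal.span_le]
      rintro _ ⟨j, rfl⟩
      exact congrFun h j
    exact fun a ha => this ha
  · exact fun h => funext fun j => h _ (Ideal.subset_span ⟨j, rfl⟩)

/-- `R_K` is representable: there is a universal point over the ring generated by the coordinates
of a generic element of `K` and of its inverse. -/
lemma exists_universal_point (K : Type u) [Field K] [Algebra ℚ K] [FiniteDimensional ℚ K] :
    ∃ (B : Type u) (_ : CommRing B) (_ : Algebra ℚ B) (b : ResPoints K B),
      ∀ (A : Type u) [CommRing A] [Algebra ℚ A] (x : ResPoints K A),
        ∃! f : B →ₐ[ℚ] A, ResPoints.map K f b = x := by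
  -- an index type in `Type u` keeps the polynomial ring in `Type u`
  let J := Module.Basis.ofVectorSpaceIndex ℚ K
  let b : Module.Basis J ℚ K := Module.Basis.ofVectorSpace ℚ K
  have : Fintype J := FiniteDimensional.fintypeBasisIndex b
  let R := MvPolynomial (J ⊕ J) ℚ
  let p : K ⊗[ℚ] R := ∑ j, b j ⊗ₜ MvPolynomial.X (Sum.inl j)
  let q : K ⊗[ℚ] R := ∑ j, b j ⊗ₜ MvPolynomial.X (Sum.inr j)
  obtain ⟨I, hI⟩ := exists_ideal_map_eq_zero_iff (p * q - 1)
  let π : R →ₐ[ℚ] R ⧸ I := Ideal.Quotient.mkₐ ℚ I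
  have hpq : Algebra.TensorProduct.map (AlgHom.id ℚ K) π p *
      Algebra.TensorProduct.map (AlgHom.id ℚ K) π q = 1 := by
    have := (hI (R ⧸ I) π).2 fun a ha => Ideal.Quotient.eq_zero_iff_mem.2 ha
    rwa [map_sub, map_mul, map_one, sub_eq_zero] at this
  refine ⟨R ⧸ I, inferInstance, inferInstance, ⟨_, _, hpq, by rw [mul_comm, hpq]⟩,
    fun A _ _ x => ?_⟩
  obtain ⟨c, hc⟩ := exists_eq_sum_tmul b (x : K ⊗[ℚ] A)
  obtain ⟨c', hc'⟩ := exists_eq_sum_tmul b ((x⁻¹ : ResPoints K A) : K ⊗[ℚ] A)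
  let f₀ : R →ₐ[ℚ] A := MvPolynomial.aeval (Sum.elim c c')
  have hX : ∀ i, f₀ (MvPolynomial.X i) = Sum.elim c c' i := MvPolynomial.aeval_X _
  have hp : Algebra.TensorProduct.map (AlgHom.id ℚ K) f₀ p = x := by simp [p, hX, hc]
  have hq : Algebra.TensorProduct.map (AlgHom.id ℚ K) f₀ q = (x⁻¹ : ResPoints K A) := by
    simp [q, hX, hc']
  have h₀ : ∀ a ∈ I, f₀ a = 0 := (hI A f₀).1 (by rw [map_sub, map_mul, hp, hq]; simp)
  have hcomp : ∀ (f : R ⧸ I →ₐ[ℚ] A) z, Algebra.TensorProduct.map (AlgHom.id ℚ K) f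
      (Algebra.TensorProduct.map (AlgHom.id ℚ K) π z) =
        Algebra.TensorProduct.map (AlgHom.id ℚ K) (f.comp π) z := by
    intro f z
    have : (Algebra.TensorProduct.map (AlgHom.id ℚ K) f).comp
      (Algebra.TensorProduct.map (AlgHom.id ℚ K) π) =
        Algebra.TensorProduct.map (AlgHom.id ℚ K) (f.comp π) := by ext <;> simp
    exact DFunLike.congr_fun this z
  refine ⟨Ideal.Quotient.liftₐ I f₀ h₀, Units.ext ?_, fun g hg => ?_⟩
  · refine (hcomp _ p).trans ?_
    rw [show (Ideal.Quotient.liftₐ I f₀ h₀).comp π = f₀ from Ideal.Quotient.liftₐ_comp I f₀ h₀, hp]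
  · refine Ideal.Quotient.algHom_ext ℚ ?_
    rw [Ideal.Quotient.liftₐ_comp]
    have hg₁ := congrArg Units.val hg
    have hg₂ := congrArg Units.inv hg
    change Algebra.TensorProduct.map (AlgHom.id ℚ K) g
      (Algebra.TensorProduct.map (AlgHom.id ℚ K) π p) = _ at hg₁
    change Algebra.TensorProduct.map (AlgHom.id ℚ K) g
      (Algebra.TensorProduct.map (AlgHom.id ℚ K) π q) = ((x⁻¹ : ResPoints K A) : K ⊗[ℚ] A) at hg₂
    rw [hcomp, ← hp, ← sub_eq_zero] at hg₁
    rw [hcomp, ← hq, ← sub_eq_zero] at hg₂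
    simp only [p, q, map_sum, Algebra.TensorProduct.map_tmul, ← Finset.sum_sub_distrib,
      ← TensorProduct.tmul_sub, AlgHom.coe_id, id] at hg₁ hg₂
    have e₁ := (sum_tmul_eq_zero_iff b _).1 hg₁
    have e₂ := (sum_tmul_eq_zero_iff b _).1 hg₂
    refine MvPolynomial.algHom_ext fun i => ?_
    rcases i with j | j
    · exact sub_eq_zero.1 (congrFun e₁ j)
    · exact sub_eq_zero.1 (congrFun e₂ j)

/-- Closed subgroup functors of `R_K` are representable. -/
lemma SubgroupFunctor.IsClosed.exists_universal_point {H : SubgroupFunctor K} (hH : H.IsClosed) :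
    ∃ (B : Type u) (_ : CommRing B) (_ : Algebra ℚ B) (b : ResPoints K B), b ∈ H.points B ∧
      ∀ (A : Type u) [CommRing A] [Algebra ℚ A] (x : ResPoints K A), x ∈ H.points A →
        ∃! f : B →ₐ[ℚ] A, ResPoints.map K f b = x := by
  obtain ⟨B, _, _, b, hb⟩ := CMTorus.exists_universal_point K
  obtain ⟨I, hI⟩ := hH B b
  refine ⟨B ⧸ I, inferInstance, inferInstance, ResPoints.map K (Ideal.Quotient.mkₐ ℚ I) b,
    (hI _ _).2 fun a ha => Ideal.Quotient.eq_zero_iff_mem.2 ha, fun A _ _ x hx => ?_⟩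
  obtain ⟨f, hf, hf'⟩ := hb A x
  have h₀ : ∀ a ∈ I, f a = 0 := (hI A f).1 (by rwa [hf])
  refine ⟨Ideal.Quotient.liftₐ I f h₀, ?_, fun g hg => ?_⟩
  · simp only
    rw [← ResPoints.map_comp, Ideal.Quotient.liftₐ_comp, hf]
  · refine Ideal.Quotient.algHom_ext ℚ ?_
    rw [Ideal.Quotient.liftₐ_comp]
    exact hf' _ ((ResPoints.map_comp _ _ _).trans hg)

/-- Kernels are closed. -/
lemma ResHom.ker_isClosed {L : Type u} [Field L] [Algebra ℚ L] (r : ResHom L K) :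
    r.ker.IsClosed := by
  intro A _ _ x
  obtain ⟨I, hI⟩ := exists_ideal_map_eq_zero_iff ((r.app A x : K ⊗[ℚ] A) - 1)
  refine ⟨I, fun B _ _ f => ?_⟩
  rw [← hI, map_sub, map_one, sub_eq_zero]
  change r.app B (ResPoints.map L f x) = 1 ↔ _
  rw [r.naturality, ← Units.val_inj]
  rfl

/-- If a closed subgroup functor `H` is dominated over an extension `Ω` of `ℚ` by a domain `D`,
i.e. all its points over `Ω`-algebras are specializations of one `D`-point, then `H` is
connected: the coordinate ring `B` of `H` embeds into `D`, since the inclusion of `B` into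
`Ω ⊗ B` factors through `D`. -/
lemma SubgroupFunctor.IsClosed.isConnected_of_isDomain {H : SubgroupFunctor K} (hH : H.IsClosed)
    {Ω : Type u} [Field Ω] [Algebra ℚ Ω] {D : Type u} [CommRing D] [IsDomain D] [Algebra ℚ D]
    [Algebra Ω D] (d : ResPoints K D) (hd : d ∈ H.points D)
    (hspec : ∀ (A : Type u) [CommRing A] [Algebra ℚ A] [Algebra Ω A] (x : ResPoints K A),
      x ∈ H.points A → ∃ f : D →ₐ[Ω] A, ResPoints.map K (f.restrictScalars ℚ) d = x) :
    H.IsConnected := by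
  obtain ⟨B, _, _, b, hb, huniv⟩ := hH.exists_universal_point
  obtain ⟨f, hf, -⟩ := huniv D d hd
  let ι : B →ₐ[ℚ] Ω ⊗[ℚ] B := Algebra.TensorProduct.includeRight
  have hι : Function.Injective ι :=
    Algebra.TensorProduct.includeRight_injective (algebraMap ℚ Ω).injective
  have hιb := H.map_mem B (Ω ⊗[ℚ] B) ι b hb
  obtain ⟨h, hh⟩ := hspec (Ω ⊗[ℚ] B) _ hιb
  have hinj : Function.Injective f := by
    have : (h.restrictScalars ℚ).comp f = ι :=
      (huniv _ _ hιb).unique (by rw [ResPoints.map_comp, hf, hh]) rfl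
    rw [← this] at hι
    exact Function.Injective.of_comp hι
  have : IsDomain B := hinj.isDomain (f : B →+* D)
  exact ⟨B, _, _, b, hb, fun A _ _ x hx => huniv A x hx, inferInstance⟩

end Closed

/-! ### The points of `GU_E` -/

section Similitudes

/-- The `A`-linear map `K ⊗ A → A` attached to a functional on `K`. -/
noncomputable def contract {K : Type u} [Field K] [Algebra ℚ K] (lam : K →ₗ[ℚ] ℚ)
    (A : Type u) [CommRing A] [Algebra ℚ A] : K ⊗[ℚ] A →ₗ[ℚ] A :=
  (TensorProduct.lid ℚ A).toLinearMap ∘ₗ lam.rTensor A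

section

variable {K : Type u} [Field K] [Algebra ℚ K] (lam : K →ₗ[ℚ] ℚ) {A B : Type u} [CommRing A]
  [Algebra ℚ A] [CommRing B] [Algebra ℚ B]

@[simp] lemma contract_tmul (x : K) (a : A) : contract lam A (x ⊗ₜ a) = lam x • a := by
  simp [contract]

lemma contract_mul_one_tmul (z : K ⊗[ℚ] A) (a : A) :
    contract lam A (z * (1 ⊗ₜ a)) = contract lam A z * a := by
  induction z with
  | zero => simp
  | tmul x y => simp
  | add x y hx hy => simp [add_mul, hx, hy]

lemma contract_map (f : A →ₐ[ℚ] B) (z : K ⊗[ℚ] A) :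
    contract lam B (Algebra.TensorProduct.map (AlgHom.id ℚ K) f z) = f (contract lam A z) := by
  induction z with
  | zero => simp
  | tmul x y => simp
  | add x y hx hy => simp [hx, hy]

/-- A point `y` of `R_K` is a scalar iff it is equal to the scalar predicted by a functional
normalized by `lam 1 = 1`. -/
lemma mem_scalars_iff (hlam : lam 1 = 1) (y : ResPoints K A) :
    y ∈ (scalars K).points A ↔ (y : K ⊗[ℚ] A) = 1 ⊗ₜ contract lam A y := by
  constructor
  · rintro ⟨a, rfl⟩
    simp [hlam]
  · intro h
    have h1 := contract_mul_one_tmul lam ((y⁻¹ : ResPoints K A) : K ⊗[ℚ] A)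
      (contract lam A (y : K ⊗[ℚ] A))
    rw [← h, Units.inv_mul, Algebra.TensorProduct.one_def, contract_tmul, hlam, one_smul] at h1
    exact ⟨Units.mkOfMulEqOne _ _ ((mul_comm _ _).trans h1.symm), Units.ext h.symm⟩

lemma scalars_isClosed (K : Type u) [Field K] [Algebra ℚ K] [FiniteDimensional ℚ K] :
    (scalars K).IsClosed := by
  intro A _ _ x
  obtain ⟨lam, hlam⟩ := (Algebra.linearMap ℚ K).exists_leftInverse_of_injective
    (LinearMap.ker_eq_bot.2 (algebraMap ℚ K).injective)
  have hlam1 : lam 1 = 1 := by simpa using DFunLike.congr_fun hlam 1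
  obtain ⟨I, hI⟩ := exists_ideal_map_eq_zero_iff
    ((x : K ⊗[ℚ] A) - 1 ⊗ₜ contract lam A (x : K ⊗[ℚ] A))
  refine ⟨I, fun B _ _ f => ?_⟩
  rw [← hI, mem_scalars_iff lam hlam1, coe_resPointsMap, contract_map, map_sub, sub_eq_zero]
  simp

end

open NumberField

variable (E : Type u) [Field E] [NumberField E] [IsCMField E]

/-- The norm `x ↦ x · x^ρ` on points of `R_E`. -/
noncomputable def conjNorm (A : Type u) [CommRing A] [Algebra ℚ A] :
    ResPoints E A →* ResPoints E A :=
  MonoidHom.id (ResPoints E A) * Units.map (conjPoints E A : E ⊗[ℚ] A →* E ⊗[ℚ] A)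

variable {E}

lemma coe_conjNorm {A : Type u} [CommRing A] [Algebra ℚ A] (x : ResPoints E A) :
    (conjNorm E A x : E ⊗[ℚ] A) = x * conjPoints E A x := rfl

lemma conjNorm_map {A B : Type u} [CommRing A] [Algebra ℚ A] [CommRing B] [Algebra ℚ B]
    (f : A →ₐ[ℚ] B) (x : ResPoints E A) :
    conjNorm E B (ResPoints.map E f x) = ResPoints.map E f (conjNorm E A x) := by
  have : (conjPoints E B).comp (Algebra.TensorProduct.map (AlgHom.id ℚ E) f) =
      (Algebra.TensorProduct.map (AlgHom.id ℚ E) f).comp (conjPoints E A) := by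
    ext <;> simp [conjPoints]
  have h := DFunLike.congr_fun this (x : E ⊗[ℚ] A)
  ext
  simp only [coe_conjNorm, coe_resPointsMap, map_mul]
  exact congrArg _ h

variable (E) in
/-- The subgroup `{x, x · x^ρ ∈ 𝔾_m}` of `R_E`. -/
noncomputable def similitudes : SubgroupFunctor E where
  points A _ _ := ((scalars E).points A).comap (conjNorm E A)
  map_mem A B _ _ _ _ f x hx := by
    rw [Subgroup.mem_comap] at hx ⊢
    rw [conjNorm_map]
    exact (scalars E).map_mem A B f _ hx

lemma mem_unitaryTorus {A : Type u} [CommRing A] [Algebra ℚ A] {x : ResPoints E A} :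
    x ∈ (unitaryTorus E).points A ↔ conjNorm E A x = 1 := Iff.rfl

lemma mem_similitudes {A : Type u} [CommRing A] [Algebra ℚ A] {x : ResPoints E A} :
    x ∈ (similitudes E).points A ↔ conjNorm E A x ∈ (scalars E).points A := Iff.rfl

lemma similitudes_isClosed : (similitudes E).IsClosed := by
  intro A _ _ x
  obtain ⟨I, hI⟩ := scalars_isClosed E A (conjNorm E A x)
  refine ⟨I, fun B _ _ f => ?_⟩
  rw [← hI, mem_similitudes, conjNorm_map]

/-- The scalar point `1 ⊗ a` of `R_E`. -/
noncomputable def scalarPoint {A : Type u} [CommRing A] [Algebra ℚ A] (a : Aˣ) : ResPoints E A :=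
  Units.map ((Algebra.TensorProduct.includeRight : A →ₐ[ℚ] E ⊗[ℚ] A) : A →* E ⊗[ℚ] A) a

lemma conjNorm_scalarPoint {A : Type u} [CommRing A] [Algebra ℚ A] (a : Aˣ) :
    conjNorm E A (scalarPoint a) = scalarPoint (a * a) := by
  ext
  simp [coe_conjNorm, scalarPoint, conjPoints]

open Polynomial in
/-- Every unit becomes a square after an injective extension of rings. -/
lemma exists_injective_sq {A : Type u} [CommRing A] [Algebra ℚ A] (a : Aˣ) :
    ∃ (B : Type u) (_ : CommRing B) (_ : Algebra ℚ B) (ι : A →ₐ[ℚ] B) (s : Bˣ),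
      Function.Injective ι ∧ s * s = Units.map (ι : A →* B) a := by
  let P : A[X] := X ^ 2 - C (a : A)
  let ι : A →ₐ[ℚ] AdjoinRoot P := IsScalarTower.toAlgHom ℚ A (AdjoinRoot P)
  have hs : AdjoinRoot.root P * AdjoinRoot.root P = ι a := by
    have := AdjoinRoot.eval₂_root P
    simp only [P, eval₂_sub, eval₂_X_pow, eval₂_C, sub_eq_zero] at this
    rw [← sq]
    exact this
  have hinv : AdjoinRoot.root P * (AdjoinRoot.root P * ι (a⁻¹ : Aˣ)) = 1 := by
    rw [← mul_assoc, hs, ← map_mul, Units.mul_inv, map_one]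
  refine ⟨AdjoinRoot P, inferInstance, inferInstance, ι, Units.mkOfMulEqOne _ _ hinv, ?_,
    Units.ext hs⟩
  have hmonic : P.Monic := monic_X_pow_sub_C _ two_ne_zero
  refine (injective_iff_map_eq_zero ι).2 fun c hc => ?_
  by_contra hne
  have : Nontrivial A := ⟨c, 0, hne⟩
  have hdvd : P ∣ C c := AdjoinRoot.mk_eq_zero.1 hc
  refine hmonic.not_dvd_of_degree_lt (by simpa using hne) ?_ hdvd
  rw [degree_X_pow_sub_C two_pos, degree_C hne]
  norm_num

/-- `GU_E` consists of the points `x` for which `x · x^ρ` is a scalar `a`. After adjoining a square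
root `s` of `a`, such a point is the product of `s` and of a point of `U_E`. -/
theorem mem_GU_iff {A : Type u} [CommRing A] [Algebra ℚ A] {x : ResPoints E A} :
    x ∈ (GU E).points A ↔ conjNorm E A x ∈ (scalars E).points A := by
  change x ∈ ⨅ (H : SubgroupFunctor E) (_ : H.IsClosed ∧ _ ∧ _), H.points A ↔ _
  simp only [Subgroup.mem_iInf]
  constructor
  · refine fun h => h (similitudes E) ⟨similitudes_isClosed, fun B _ _ y hy => ?_,
      fun B _ _ y hy => ?_⟩
    · rw [mem_similitudes, mem_unitaryTorus.1 hy]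
      exact one_mem _
    · obtain ⟨a, rfl⟩ := hy
      exact ⟨a * a, (conjNorm_scalarPoint a).symm⟩
  · rintro ⟨a, ha⟩ H ⟨hH, hU, hG⟩
    obtain ⟨B, _, _, ι, s, hι, hs⟩ := exists_injective_sq a
    have hsH : scalarPoint s ∈ H.points B := hG B ⟨s, rfl⟩
    have hxs : ResPoints.map E ι x * (scalarPoint s)⁻¹ ∈ H.points B := by
      refine hU B (mem_unitaryTorus.2 ?_)
      rw [map_mul, map_inv, conjNorm_map, ← ha, conjNorm_scalarPoint, hs, mul_inv_eq_one]
      ext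
      simp [scalarPoint]
    have hxB : ResPoints.map E ι x ∈ H.points B := by
      simpa using mul_mem hxs hsH
    obtain ⟨I, hI⟩ := hH A x
    rw [← ResPoints.map_id x, hI]
    exact fun c hc => hι (((hI B ι).1 hxB c hc).trans (map_zero ι).symm)

end Similitudes

/-! ### The Galois action on CM types -/

section Galois

open NumberField

section Conj

variable {E : Type u} [Field E] [NumberField E] [IsCMField E] {L : Type u} [Field L] [Algebra ℚ L]

/-- The complex conjugate `φ ∘ ρ` of an embedding `φ` of `E`. -/
noncomputable def conj (φ : E →ₐ[ℚ] L) : E →ₐ[ℚ] L :=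
  φ.comp ((IsCMField.complexConj E).restrictScalars ℚ : E →ₐ[ℚ] E)

@[simp] lemma conj_apply (φ : E →ₐ[ℚ] L) (x : E) :
    conj φ x = φ (IsCMField.complexConj E x) := rfl

@[simp] lemma conj_conj (φ : E →ₐ[ℚ] L) : conj (conj φ) = φ := by
  ext x
  simp

lemma comp_conj {M : Type u} [Field M] [Algebra ℚ M] (β : L →ₐ[ℚ] M) (φ : E →ₐ[ℚ] L) :
    β.comp (conj φ) = conj (β.comp φ) := rfl

lemma isCMType_iff {S : Set (E →ₐ[ℚ] L)} :
    IsCMType E S ↔ ∀ φ, conj φ ∈ S ↔ φ ∉ S := by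
  have hi : (fun φ : E →ₐ[ℚ] L =>
      φ.comp ((IsCMField.complexConj E).restrictScalars ℚ : E →ₐ[ℚ] E)) '' S =
      {φ | conj φ ∈ S} := by
    ext φ
    constructor
    · rintro ⟨φ, h, rfl⟩
      change conj (conj φ) ∈ S
      rwa [conj_conj]
    · exact fun h => ⟨conj φ, h, conj_conj φ⟩
  rw [IsCMType, hi, Set.disjoint_left, Set.eq_univ_iff_forall]
  simp only [Set.mem_union, Set.mem_ofPred_eq]
  exact ⟨fun h φ => ⟨fun h1 h2 => h.2 h2 h1, (h.1 φ).resolve_left⟩,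
    fun h => ⟨fun φ => or_iff_not_imp_left.2 (h φ).2, fun φ h1 h2 => (h φ).1 h2 h1⟩⟩

lemma component_conjPoints {A : Type u} [CommRing A] [Algebra ℚ A] [Algebra L A]
    (φ : E →ₐ[ℚ] L) (z : E ⊗[ℚ] A) :
    component A φ (conjPoints E A z) = component A (conj φ) z := by
  have : (component A φ).comp (conjPoints E A) = component A (conj φ) := by
    ext <;> simp [conjPoints]
  exact DFunLike.congr_fun this z

lemma unitComponent_conjNorm {A : Type u} [CommRing A] [Algebra ℚ A] [Algebra L A]
    (φ : E →ₐ[ℚ] L) (x : ResPoints E A) :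
    unitComponent A φ (conjNorm E A x) = unitComponent A φ x * unitComponent A (conj φ) x := by
  ext
  simp [coe_conjNorm, component_conjPoints]

/-- Two embeddings of `E` that agree on the maximal totally real subfield are equal or complex
conjugate: each `x` is sent to one of two possible values, and a group is not the union of two
proper subgroups. -/
lemma eq_or_eq_conj {φ ψ : E →ₐ[ℚ] L}
    (h : ∀ x : maximalRealSubfield E, φ x = ψ x) : ψ = φ ∨ ψ = conj φ := by
  have hx : ∀ x, ψ x = φ x ∨ ψ x = conj φ x := by
    intro x
    have h1 : x + IsCMField.complexConj E x ∈ maximalRealSubfield E := by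
      rw [← IsCMField.complexConj_eq_self_iff]
      simp [add_comm]
    have h2 : x * IsCMField.complexConj E x ∈ maximalRealSubfield E := by
      rw [← IsCMField.complexConj_eq_self_iff]
      simp [mul_comm]
    have h1' := h ⟨_, h1⟩
    have h2' := h ⟨_, h2⟩
    simp only [map_add, map_mul] at h1' h2'
    rw [← sub_eq_zero, ← sub_eq_zero (a := ψ x), ← mul_eq_zero, conj_apply]
    linear_combination h2' - ψ x * h1'
  by_contra! hne
  obtain ⟨x, hx1⟩ := DFunLike.ne_iff.1 hne.1
  obtain ⟨y, hy1⟩ := DFunLike.ne_iff.1 hne.2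
  have hx2 := (hx x).resolve_left hx1
  have hy2 := (hx y).resolve_right hy1
  rcases hx (x + y) with h3 | h3 <;> simp only [map_add] at h3
  · exact hx1 (by rw [hy2] at h3; exact add_right_cancel h3)
  · exact hy1 (by rw [hx2] at h3; exact add_left_cancel h3)

end Conj

variable {E : Type u} [Field E] [NumberField E] [IsCMField E]
  {Ec : Type u} [Field Ec] [Algebra ℚ Ec] [IsNormalClosure ℚ E Ec]

/-- An automorphism of `E^c` that is trivial on `F^c` preserves each pair of complex conjugate
embeddings. -/
lemma comp_eq_or_eq_conj {σ : Ec ≃ₐ[ℚ] Ec} (hσ : σ ∈ (restrictGal E Ec).ker)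
    (φ : E →ₐ[ℚ] Ec) :
    (σ : Ec →ₐ[ℚ] Ec).comp φ = φ ∨ (σ : Ec →ₐ[ℚ] Ec).comp φ = conj φ := by
  refine eq_or_eq_conj fun x => ?_
  have := realClosure_normal E Ec
  let f : maximalRealSubfield E →ₐ[ℚ] Ec :=
    ((φ : E →+* Ec).comp (algebraMap (maximalRealSubfield E) E)).toRatAlgHom
  have hf : f x ∈ IntermediateField.normalClosure ℚ (maximalRealSubfield E) Ec :=
    f.fieldRange_le_normalClosure ⟨x, rfl⟩
  let y : RealClosure E Ec := ⟨f x, hf⟩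
  have h1 : algebraMap (RealClosure E Ec) Ec (restrictGal E Ec σ y) =
      σ (algebraMap (RealClosure E Ec) Ec y) := AlgEquiv.restrictNormal_commutes σ _ y
  rw [MonoidHom.mem_ker.1 hσ] at h1
  exact h1

omit [IsCMField E] in
/-- An automorphism of `E^c` is determined by its action on the embeddings of `E`. -/
lemma galois_ext {σ τ : Ec ≃ₐ[ℚ] Ec}
    (h : ∀ φ : E →ₐ[ℚ] Ec, (σ : Ec →ₐ[ℚ] Ec).comp φ = (τ : Ec →ₐ[ℚ] Ec).comp φ) : σ = τ := by
  have htop : IntermediateField.normalClosure ℚ E Ec = ⊤ :=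
    (Algebra.IsAlgebraic.isNormalClosure_iff.mp inferInstance).2
  have hle : IntermediateField.normalClosure ℚ E Ec ≤
      IntermediateField.fixedField (Subgroup.zpowers (τ⁻¹ * σ)) := by
    rw [normalClosure_le_iff]
    rintro φ _ ⟨x, rfl⟩
    refine (IntermediateField.mem_fixedField_iff _ _).2 fun s hs => ?_
    have hfix : (τ⁻¹ * σ) (φ x) = φ x :=
      (congrArg τ.symm (DFunLike.congr_fun (h φ) x)).trans (τ.symm_apply_apply _)
    exact MulAction.mem_stabilizer_iff.1
      ((Subgroup.zpowers_le (H := MulAction.stabilizer (Ec ≃ₐ[ℚ] Ec) (φ x))).2 hfix hs)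
  ext x
  have hx := (IntermediateField.mem_fixedField_iff _ _).1 (hle (htop ▸ IntermediateField.mem_top :
    x ∈ IntermediateField.normalClosure ℚ E Ec)) _ (Subgroup.mem_zpowers _)
  exact (τ.apply_symm_apply _).symm.trans (congrArg τ hx)

/-- If `Gal(E^c/F^c)` has `2 ^ g` elements, then it realizes all choices of signs on the pairs of
conjugate embeddings, so that the CM types of `E` form one orbit under `Gal(E^c/ℚ)`. -/
theorem exists_galois_comp_mem_iff {g : ℕ} (hg : Module.finrank ℚ E = 2 * g)
    (hcard : Nat.card (restrictGal E Ec).ker = 2 ^ g) {S S' : Set (E →ₐ[ℚ] Ec)}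
    (hS : IsCMType E S) (hS' : IsCMType E S') :
    ∃ σ : Ec ≃ₐ[ℚ] Ec, ∀ φ, (σ : Ec →ₐ[ℚ] Ec).comp φ ∈ S' ↔ φ ∈ S := by
  rw [isCMType_iff] at hS hS'
  have : FiniteDimensional ℚ Ec := finiteDimensional_of_isNormalClosure ℚ E Ec
  have hSc : Nat.card S = g := by
    have h1 : Nat.card (E →ₐ[ℚ] Ec) = 2 * g := by
      rw [Nat.card_eq_fintype_card, AlgHom.card_of_splits ℚ E Ec IsNormalClosure.splits, hg]
    have h2 : S.ncard = Sᶜ.ncard := by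
      refine Set.ncard_congr (fun φ _ => conj φ) (fun φ h => ?_) (fun φ ψ _ _ h => ?_)
        fun φ h => ⟨conj φ, (hS φ).2 h, conj_conj φ⟩
      · exact (hS (conj φ)).1 (by rwa [conj_conj])
      · rw [← conj_conj φ, h, conj_conj]
    have h3 := Set.ncard_add_ncard_compl S
    rw [h1] at h3
    change S.ncard = g
    omega
  -- the embeddings in `S` whose sign is changed by `σ`
  let flips (σ : (restrictGal E Ec).ker) : Set S :=
    {φ : S | ((σ : Ec ≃ₐ[ℚ] Ec) : Ec →ₐ[ℚ] Ec).comp (φ : E →ₐ[ℚ] Ec) ≠ φ}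
  have hinj : Function.Injective flips := by
    intro σ τ h
    have hmem : ∀ φ ∈ S, ((σ : Ec ≃ₐ[ℚ] Ec) : Ec →ₐ[ℚ] Ec).comp φ =
        ((τ : Ec ≃ₐ[ℚ] Ec) : Ec →ₐ[ℚ] Ec).comp φ := by
      intro φ hφ
      have h1 : ((σ : Ec ≃ₐ[ℚ] Ec) : Ec →ₐ[ℚ] Ec).comp φ ≠ φ ↔
        ((τ : Ec ≃ₐ[ℚ] Ec) : Ec →ₐ[ℚ] Ec).comp φ ≠ φ := Set.ext_iff.1 h ⟨φ, hφ⟩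
      rcases comp_eq_or_eq_conj σ.2 φ with h2 | h2 <;>
        rcases comp_eq_or_eq_conj τ.2 φ with h3 | h3 <;> grind
    refine Subtype.ext (galois_ext (E := E) fun φ => ?_)
    by_cases hφ : φ ∈ S
    · exact hmem φ hφ
    · have := congrArg conj (hmem _ ((hS φ).2 hφ))
      simpa only [← comp_conj, conj_conj] using this
  -- source and target both have `2 ^ g` elements
  have hbij : Function.Bijective flips := by
    refine hinj.bijective_of_nat_card_le ?_
    have := Fintype.ofFinite S
    rw [hcard, Nat.card_eq_fintype_card, Fintype.card_set, ← Nat.card_eq_fintype_card, hSc]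
  -- a sign has to be changed exactly where `S` and `S'` differ
  obtain ⟨σ, hσ⟩ := hbij.2 {φ | (φ : E →ₐ[ℚ] Ec) ∉ S'}
  have hmem : ∀ φ ∈ S, ((σ : Ec ≃ₐ[ℚ] Ec) : Ec →ₐ[ℚ] Ec).comp φ ∈ S' := by
    intro φ hφ
    have h1 : ((σ : Ec ≃ₐ[ℚ] Ec) : Ec →ₐ[ℚ] Ec).comp φ ≠ φ ↔ φ ∉ S' := Set.ext_iff.1 hσ ⟨φ, hφ⟩
    by_cases h2 : φ ∈ S'
    · rwa [not_ne_iff.1 (h1.not.2 (not_not.2 h2))]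
    · rw [(comp_eq_or_eq_conj σ.2 φ).resolve_left (h1.2 h2)]
      exact (hS' φ).2 h2
  refine ⟨σ, fun φ => ⟨fun h => ?_, hmem φ⟩⟩
  by_contra hφ
  have h1 := hmem _ ((hS φ).2 hφ)
  rw [comp_conj] at h1
  exact (hS' _).1 h1 h

end Galois

/-! ### The translates of a CM type -/

section Translates

open NumberField

variable {E Ec Ω : Type u} [Field E] [Algebra ℚ E] [Field Ec] [Algebra ℚ Ec]
  [FiniteDimensional ℚ E] [IsNormalClosure ℚ E Ec] [Field Ω] [Algebra ℚ Ω]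

/-- For an embedding `β` of `Ec`, the translate of `S` by the restriction of `β` to the reflex field
is `β ∘ S`. -/
lemma comp_mem_translate_iff (S : Set (E →ₐ[ℚ] Ec)) (β : Ec →ₐ[ℚ] Ω) (φ : E →ₐ[ℚ] Ec) :
    β.comp φ ∈ translate S (β.comp (IsScalarTower.toAlgHom ℚ (ReflexField S) Ec)) ↔ φ ∈ S := by
  classical
  have h : Algebra.TensorProduct.productMap (β.comp φ)
      (β.comp (IsScalarTower.toAlgHom ℚ (ReflexField S) Ec)) =
        β.comp (evalAt (ReflexField S) φ) := by
    ext <;> simp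
  rw [mem_translate, h, AlgHom.comp_apply, typeIdempotent, (exists_idempotent S).choose_spec φ]
  split_ifs with h <;> simp [h]

variable [IsAlgClosed Ω]

lemma exists_extends (S : Set (E →ₐ[ℚ] Ec)) (ψ : ReflexField S →ₐ[ℚ] Ω) :
    ∃ β : Ec →ₐ[ℚ] Ω, β.comp (IsScalarTower.toAlgHom ℚ (ReflexField S) Ec) = ψ := by
  have : FiniteDimensional ℚ Ec := finiteDimensional_of_isNormalClosure ℚ E Ec
  have := Algebra.IsAlgebraic.tower_top (K := ℚ) (ReflexField S) (A := Ec)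
  let := (ψ : ReflexField S →+* Ω).toAlgebra
  let β : Ec →ₐ[ReflexField S] Ω := IsAlgClosed.lift
  exact ⟨(β : Ec →+* Ω).toRatAlgHom, AlgHom.ext fun x => β.commutes x⟩

/-- Every embedding of `E` into `Ω` factors through a given embedding of its normal closure. -/
lemma exists_comp_eq (β : Ec →ₐ[ℚ] Ω) (φ : E →ₐ[ℚ] Ω) : ∃ φ' : E →ₐ[ℚ] Ec, β.comp φ' = φ := by
  have hinj : Function.Injective fun φ' : E →ₐ[ℚ] Ec => β.comp φ' := fun a b h =>
    AlgHom.ext fun x => β.injective (DFunLike.congr_fun h x)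
  refine (hinj.bijective_of_nat_card_le ?_).2 φ
  rw [Nat.card_eq_fintype_card, Nat.card_eq_fintype_card, AlgHom.card,
    AlgHom.card_of_splits ℚ E Ec IsNormalClosure.splits]

end Translates

section CMTranslates

open NumberField

variable {E : Type u} [Field E] [NumberField E] [IsCMField E]
  {Ec : Type u} [Field Ec] [Algebra ℚ Ec] [IsNormalClosure ℚ E Ec]
  {Ω : Type u} [Field Ω] [Algebra ℚ Ω] [IsAlgClosed Ω]

lemma isCMType_translate {S : Set (E →ₐ[ℚ] Ec)} (hS : IsCMType E S)
    (ψ : ReflexField S →ₐ[ℚ] Ω) : IsCMType E (translate S ψ) := by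
  rw [isCMType_iff] at hS ⊢
  intro φ
  obtain ⟨β, rfl⟩ := exists_extends S ψ
  obtain ⟨φ', rfl⟩ := exists_comp_eq β φ
  rw [← comp_conj, comp_mem_translate_iff, comp_mem_translate_iff, hS]

/-- All CM types on `E` with values in `Ω` are translates of `S`. -/
theorem exists_translate_eq {g : ℕ} (hg : Module.finrank ℚ E = 2 * g)
    (hcard : Nat.card (restrictGal E Ec).ker = 2 ^ g) {S : Set (E →ₐ[ℚ] Ec)}
    (hS : IsCMType E S) {T : Set (E →ₐ[ℚ] Ω)} (hT : IsCMType E T) :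
    ∃ ψ : ReflexField S →ₐ[ℚ] Ω, translate S ψ = T := by
  have : FiniteDimensional ℚ Ec := finiteDimensional_of_isNormalClosure ℚ E Ec
  let j : Ec →ₐ[ℚ] Ω := IsAlgClosed.lift
  obtain ⟨σ, hσ⟩ := exists_galois_comp_mem_iff hg hcard hS
    (S' := {φ | j.comp φ ∈ T}) (isCMType_iff.2 fun φ => isCMType_iff.1 hT (j.comp φ))
  let β : Ec →ₐ[ℚ] Ω := j.comp (σ : Ec →ₐ[ℚ] Ec)
  refine ⟨β.comp (IsScalarTower.toAlgHom ℚ (ReflexField S) Ec), Set.ext fun φ => ?_⟩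
  obtain ⟨φ', rfl⟩ := exists_comp_eq β φ
  rw [comp_mem_translate_iff, ← hσ]
  rfl

end CMTranslates

/-! ### Lattices spanned by CM types -/

section Lattice

open NumberField Classical

variable {E : Type u} [Field E] [NumberField E] [IsCMField E] {L : Type u} [Field L] [Algebra ℚ L]

/-- The CM type obtained from `T` by exchanging `χ` and its complex conjugate. -/
def flip (T : Set (E →ₐ[ℚ] L)) (χ : E →ₐ[ℚ] L) : Set (E →ₐ[ℚ] L) :=
  {φ | if φ = χ ∨ φ = conj χ then φ ∉ T else φ ∈ T}

lemma mem_flip {T : Set (E →ₐ[ℚ] L)} {χ φ : E →ₐ[ℚ] L} :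
    φ ∈ flip T χ ↔ if φ = χ ∨ φ = conj χ then φ ∉ T else φ ∈ T := Iff.rfl

lemma conj_eq_iff {φ χ : E →ₐ[ℚ] L} : conj φ = χ ↔ φ = conj χ :=
  ⟨fun h => by rw [← h, conj_conj], fun h => by rw [h, conj_conj]⟩

lemma isCMType_flip {T : Set (E →ₐ[ℚ] L)} (hT : IsCMType E T) (χ : E →ₐ[ℚ] L) :
    IsCMType E (flip T χ) := by
  rw [isCMType_iff] at hT ⊢
  intro φ
  have h : (conj φ = χ ∨ conj φ = conj χ) ↔ (φ = χ ∨ φ = conj χ) := by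
    rw [conj_eq_iff, conj_eq_iff, conj_conj, or_comm]
  by_cases h' : φ = χ ∨ φ = conj χ
  · rw [mem_flip, mem_flip, if_pos h', if_pos (h.2 h'), hT]
  · rw [mem_flip, mem_flip, if_neg h', if_neg (h.not.2 h'), hT]

lemma isCMType_compl {T : Set (E →ₐ[ℚ] L)} (hT : IsCMType E T) : IsCMType E Tᶜ := by
  rw [isCMType_iff] at hT ⊢
  intro φ
  rw [Set.mem_compl_iff, Set.mem_compl_iff, hT]

/-- The sum of a function over the embeddings in `T`. -/
noncomputable def typeSum {X : Type*} [Fintype X] (T : Set X) (c : X → ℤ) : ℤ :=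
  ∑ φ, if φ ∈ T then c φ else 0

/-- The sum over one CM type `T`, indexed by the elements of another one: each conjugate pair has
exactly one member in either type. -/
lemma typeSum_eq {T₀ T : Set (E →ₐ[ℚ] L)} (h₀ : IsCMType E T₀) (hT : IsCMType E T)
    (c : (E →ₐ[ℚ] L) → ℤ) :
    typeSum T c = typeSum T₀ fun φ => if φ ∈ T then c φ else c (conj φ) := by
  rw [isCMType_iff] at h₀ hT
  have h1 : ∑ φ, (if φ ∈ T₀ then 0 else if φ ∈ T then c φ else 0) =
      ∑ φ, if φ ∈ T₀ then (if φ ∈ T then 0 else c (conj φ)) else 0 := by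
    refine Fintype.sum_bijective conj (Function.Involutive.bijective conj_conj) _ _ fun φ => ?_
    have := h₀ φ
    have := hT φ
    rw [conj_conj]
    grind
  have h2 : typeSum T c = ∑ φ, (if φ ∈ T₀ then (if φ ∈ T then c φ else 0) else 0) +
      ∑ φ, (if φ ∈ T₀ then 0 else if φ ∈ T then c φ else 0) := by
    rw [← Finset.sum_add_distrib]
    refine Finset.sum_congr rfl fun φ _ => ?_
    split_ifs <;> simp
  rw [h2, h1, ← Finset.sum_add_distrib]
  refine Finset.sum_congr rfl fun φ _ => ?_
  split_ifs <;> simp [*]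

lemma typeSum_add {X : Type*} [Fintype X] (T : Set X) (c c' : X → ℤ) :
    typeSum T (c + c') = typeSum T c + typeSum T c' := by
  simp only [typeSum, ← Finset.sum_add_distrib, Pi.add_apply]
  exact Finset.sum_congr rfl fun φ _ => by split_ifs <;> simp

lemma typeSum_single {X : Type*} [Fintype X] (T : Set X) (φ : X) (k : ℤ) :
    typeSum T (Pi.single φ k) = if φ ∈ T then k else 0 := by
  rw [typeSum, Finset.sum_eq_single φ]
  · simp
  · intro ψ _ h
    simp [h]
  · simp

lemma typeSum_flip {T : Set (E →ₐ[ℚ] L)} (hT : IsCMType E T) {χ : E →ₐ[ℚ] L} (hχ : χ ∈ T)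
    (c : (E →ₐ[ℚ] L) → ℤ) :
    typeSum (flip T χ) c = typeSum T c + (c (conj χ) - c χ) := by
  have h1 : typeSum T (Pi.single χ (c (conj χ) - c χ)) = c (conj χ) - c χ := by
    rw [typeSum_single, if_pos hχ]
  rw [typeSum_eq hT (isCMType_flip hT χ), ← h1, ← typeSum_add]
  refine Finset.sum_congr rfl fun φ _ => ?_
  have hn : φ ∈ T → φ ≠ conj χ := fun h h' =>
    (isCMType_iff.1 hT χ).1 (h' ▸ h) hχ
  by_cases h : φ ∈ T
  · by_cases h' : φ = χ
    · subst h'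
      simp [mem_flip, h]
    · simp [mem_flip, h, h', hn h]
  · simp [h]

variable {Ψ : Type*}

/-- The homomorphism `ℤ^Ψ → ℤ^{Hom(E, L)}`, `e_ψ ↦ ∑_{φ ∈ T_ψ} [φ]`, of a family of sets `T_ψ`. -/
noncomputable def spanHom [Fintype Ψ] {X : Type*} (T : Ψ → Set X) : (Ψ → ℤ) →+ (X → ℤ) where
  toFun n φ := typeSum {ψ | φ ∈ T ψ} n
  map_zero' := by funext φ; simp [typeSum]
  map_add' n n' := by funext φ; exact typeSum_add _ _ _

/-- The transpose `[φ] ↦ ∑_{T_ψ ∋ φ} e_ψ` of `spanHom`. -/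
noncomputable def cospanHom {X : Type*} [Fintype X] (T : Ψ → Set X) : (X → ℤ) →+ (Ψ → ℤ) where
  toFun c ψ := typeSum (T ψ) c
  map_zero' := by funext φ; simp [typeSum]
  map_add' n n' := by funext φ; exact typeSum_add _ _ _

/-- The indicator functions of all CM types span the functions `f` for which
`f(φ) + f(φρ)` is constant. -/
lemma mem_range_spanHom [Fintype Ψ] {T : Ψ → Set (E →ₐ[ℚ] L)}
    (hT : ∀ T', IsCMType E T' → ∃ ψ, T ψ = T') {T₀ : Set (E →ₐ[ℚ] L)} (h₀ : IsCMType E T₀) {f : (E →ₐ[ℚ] L) → ℤ} {k : ℤ}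
    (hf : ∀ φ, f φ + f (conj φ) = k) : f ∈ (spanHom T).range := by
  have hind : ∀ T', IsCMType E T' →
      (fun φ => if φ ∈ T' then (1 : ℤ) else 0) ∈ (spanHom T).range := by
    intro T' h'
    obtain ⟨ψ, rfl⟩ := hT T' h'
    refine ⟨Pi.single ψ 1, funext fun φ => ?_⟩
    simp [spanHom, typeSum_single]
  -- `f = k [T₀ρ] + ∑_{χ ∈ T₀} f(χ) ([T₀] - [T₀ with χ flipped])`
  have key : f = k • (fun φ => if φ ∈ T₀ᶜ then (1 : ℤ) else 0) +
      ∑ χ, (if χ ∈ T₀ then f χ else 0) • ((fun φ => if φ ∈ T₀ then (1 : ℤ) else 0) -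
        fun φ => if φ ∈ flip T₀ χ then (1 : ℤ) else 0) := by
    funext φ
    have hφ := isCMType_iff.1 h₀ φ
    have hne : conj φ ≠ φ := fun h => by rw [h] at hφ; tauto
    simp only [Pi.add_apply, Pi.smul_apply, Finset.sum_apply, Pi.sub_apply, smul_eq_mul]
    by_cases h : φ ∈ T₀
    · rw [Finset.sum_eq_single φ]
      · simp [h, mem_flip]
      · intro χ _ hχ
        have : φ = conj χ → χ ∉ T₀ := fun h' => by rw [← conj_eq_iff] at h'; grind
        by_cases h2 : χ ∈ T₀
        · have h3 : φ ≠ conj χ := fun h' => this h' h2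
          simp [mem_flip, h, hχ.symm, h3]
        · simp [h2]
      · simp
    · rw [Finset.sum_eq_single (conj φ)]
      · simp [h, mem_flip, hφ]
        linarith [hf φ]
      · intro χ _ hχ
        have h3 : φ ≠ conj χ := fun h' => hχ (conj_eq_iff.2 h').symm
        by_cases h2 : χ ∈ T₀
        · have h4 : φ ≠ χ := fun h' => h (h' ▸ h2)
          simp [mem_flip, h, h3, h4]
        · simp [h2]
      · simp
  rw [key]
  refine add_mem (AddSubgroup.zsmul_mem _ ?_ _) (sum_mem fun χ _ =>
    AddSubgroup.zsmul_mem _ (sub_mem (hind _ h₀) (hind _ (isCMType_flip h₀ χ))) _)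
  convert hind _ (isCMType_compl h₀)

/-- If `T_ψ` runs through all CM types, then the image of `[φ] ↦ ∑_{T_ψ ∋ φ} e_ψ` is saturated. -/
lemma mem_range_cospanHom_of_smul {T : Ψ → Set (E →ₐ[ℚ] L)} (hT : ∀ ψ, IsCMType E (T ψ))
    (hT' : ∀ T', IsCMType E T' → ∃ ψ, T ψ = T') [Nonempty (E →ₐ[ℚ] L)] {m : Ψ → ℤ} {k : ℤ}
    (hk : k ≠ 0) (hm : k • m ∈ (cospanHom T).range) : m ∈ (cospanHom T).range := by
  obtain ⟨c, hc⟩ := hm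
  have hc : ∀ ψ, typeSum (T ψ) c = k * m ψ := fun ψ => congrFun hc ψ
  by_cases hΨ : Nonempty Ψ
  swap
  · exact ⟨0, funext fun ψ => (hΨ ⟨ψ⟩).elim⟩
  obtain ⟨ψ₀⟩ := hΨ
  obtain ⟨φ₀⟩ := ‹Nonempty (E →ₐ[ℚ] L)›
  obtain ⟨ψ₁, hψ₁⟩ := hT' _ (isCMType_compl (hT ψ₀))
  choose ψ' hψ' using fun χ => hT' _ (isCMType_flip (hT ψ₀) χ)
  -- comparing two CM types that differ at `χ` shows that `k` divides `c(χ) - c(χρ)`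
  have h1 : ∀ χ ∈ T ψ₀, k * (m ψ₀ - m (ψ' χ)) = c χ - c (conj χ) := by
    intro χ hχ
    have := typeSum_flip (hT ψ₀) hχ c
    rw [← hψ', hc, hc] at this
    linarith
  -- the quotients give a preimage up to a constant function, which is the image of a multiple of
  -- `[φ₀] + [φ₀ρ]`
  let a : (E →ₐ[ℚ] L) → ℤ := fun χ => if χ ∈ T ψ₀ then m ψ₀ - m (ψ' χ) else 0
  refine ⟨a + (Pi.single φ₀ (m ψ₁) + Pi.single (conj φ₀) (m ψ₁)), funext fun ψ => ?_⟩
  change typeSum (T ψ) _ = m ψ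
  have h2 : typeSum (T ψ) (Pi.single φ₀ (m ψ₁)) + typeSum (T ψ) (Pi.single (conj φ₀) (m ψ₁)) =
      m ψ₁ := by
    rw [typeSum_single, typeSum_single]
    have := isCMType_iff.1 (hT ψ) φ₀
    by_cases h : φ₀ ∈ T ψ <;> simp [this, h]
  rw [typeSum_add, typeSum_add, h2]
  refine mul_left_cancel₀ hk ?_
  rw [mul_add, ← hc, ← hc, hψ₁, typeSum_eq (hT ψ₀) (hT ψ), typeSum_eq (hT ψ₀) (hT ψ) c,
    typeSum_eq (hT ψ₀) (isCMType_compl (hT ψ₀)) c]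
  simp only [typeSum, Finset.mul_sum, ← Finset.sum_add_distrib]
  refine Finset.sum_congr rfl fun φ _ => ?_
  by_cases h : φ ∈ T ψ₀
  · have h' : conj φ ∉ T ψ₀ := fun h' => (isCMType_iff.1 (hT ψ₀) φ).1 h' h
    by_cases h3 : φ ∈ T ψ
    · simp [h, h3, a, h1 φ h]
    · simp [h, h3, a, h']
  · simp [h]

end Lattice

/-! ### The image on cocharacters -/

section Main

open NumberField Classical

variable {E : Type u} [Field E] [NumberField E] [IsCMField E]
  {Ec : Type u} [Field Ec] [Algebra ℚ Ec] [IsNormalClosure ℚ E Ec]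
  {Ω : Type u} [Field Ω] [Algebra ℚ Ω] [IsAlgClosed Ω]

lemma mem_cocharacters_GU_iff {l : Cocharacter E Ω} {f : (E →ₐ[ℚ] Ω) → ℤ}
    (hf : ∀ (A : Type u) [CommRing A] [Algebra ℚ A] [Algebra Ω A] (t : Aˣ)
      (φ : E →ₐ[ℚ] Ω), unitComponent A φ (l.app A t) = t ^ f φ) :
    l ∈ (GU E).cocharacters Ω ↔ ∃ k, ∀ φ, f φ + f (conj φ) = k := by
  have hn : ∀ (A : Type u) [CommRing A] [Algebra ℚ A] [Algebra Ω A] (t : Aˣ)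
      (φ : E →ₐ[ℚ] Ω), unitComponent A φ (conjNorm E A (l.app A t)) = t ^ (f φ + f (conj φ)) := by
    intro A _ _ _ t φ
    rw [unitComponent_conjNorm, hf, hf, zpow_add]
  have hs : ∀ (A : Type u) [CommRing A] [Algebra ℚ A] [Algebra Ω A] (a : Aˣ)
      (φ : E →ₐ[ℚ] Ω), unitComponent A φ (scalarPoint a) = a := by
    intro A _ _ _ a φ
    ext
    simp [scalarPoint]
  constructor
  · intro h
    obtain ⟨a, ha⟩ := mem_GU_iff.1 (h (LaurentPolynomial Ω) (unitT Ω))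
    change scalarPoint a = _ at ha
    have h1 : ∀ φ, unitT Ω ^ (f φ + f (conj φ)) = a := fun φ => by rw [← hn, ← ha, hs]
    obtain ⟨φ₀⟩ : Nonempty (E →ₐ[ℚ] Ω) := ⟨IsAlgClosed.lift⟩
    exact ⟨_, fun φ => unitT_zpow_injective ((h1 φ).trans (h1 φ₀).symm)⟩
  · rintro ⟨k, hk⟩ A _ _ _ t
    refine mem_GU_iff.2 ⟨t ^ k, unitComponent_injective (Ω := Ω) fun φ => ?_⟩
    rw [hn, hk]
    exact hs A _ φ

omit [IsCMField E] in
lemma unitComponent_reciprocity_zpow (S : Set (E →ₐ[ℚ] Ec)) {l : Cocharacter (ReflexField S) Ω}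
    {n : (ReflexField S →ₐ[ℚ] Ω) → ℤ}
    (hn : ∀ (A : Type u) [CommRing A] [Algebra ℚ A] [Algebra Ω A] (t : Aˣ)
      (ψ : ReflexField S →ₐ[ℚ] Ω), unitComponent A ψ (l.app A t) = t ^ n ψ)
    (A : Type u) [CommRing A] [Algebra ℚ A] [Algebra Ω A] (t : Aˣ) (φ : E →ₐ[ℚ] Ω) :
    haveI := finiteDimensional_reflexField S
    unitComponent A φ (((reciprocity S).onCocharacters Ω l).app A t) =
      t ^ spanHom (translate (Ω := Ω) S) n φ := by
  have := finiteDimensional_reflexField S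
  refine (unitComponent_reciprocity S (l.app A t) φ).trans ?_
  change _ = zpowersHom Aˣ t (.ofAdd (∑ ψ, _))
  rw [ofAdd_sum, map_prod]
  refine Finset.prod_congr rfl fun ψ _ => ?_
  simp only [Set.mem_ofPred_eq]
  split_ifs
  · exact hn A t ψ
  · simp

/-- If all CM types are translates of `S`, the reciprocity morphism maps onto the cocharacters
of `GU_E`. -/
theorem Lmu_eq_cocharacters_GU {S : Set (E →ₐ[ℚ] Ec)} (hS : IsCMType E S)
    (htr : ∀ T : Set (E →ₐ[ℚ] Ω), IsCMType E T → ∃ ψ : ReflexField S →ₐ[ℚ] Ω, translate S ψ = T) :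
    Lmu S Ω = (GU E).cocharacters Ω := by
  have := finiteDimensional_reflexField S
  ext l
  constructor
  · rintro ⟨l', rfl⟩
    obtain ⟨n, hn⟩ := l'.exists_exponents
    refine (mem_cocharacters_GU_iff (unitComponent_reciprocity_zpow S hn)).2 ⟨∑ ψ, n ψ, fun φ => ?_⟩
    change ∑ ψ, _ + ∑ ψ, _ = _
    rw [← Finset.sum_add_distrib]
    refine Finset.sum_congr rfl fun ψ _ => ?_
    have := isCMType_iff.1 (isCMType_translate hS ψ) φ
    by_cases h : φ ∈ translate S ψ <;> simp [this, h]
  · intro hl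
    obtain ⟨f, hf⟩ := l.exists_exponents
    obtain ⟨k, hk⟩ := (mem_cocharacters_GU_iff hf).1 hl
    obtain ⟨ψ₀⟩ : Nonempty (ReflexField S →ₐ[ℚ] Ω) := ⟨IsAlgClosed.lift⟩
    obtain ⟨n, rfl⟩ := mem_range_spanHom htr (isCMType_translate hS ψ₀) hk
    obtain ⟨l', hl'⟩ := Cocharacter.exists_of_exponents n
    refine ⟨l', Cocharacter.ext ?_⟩
    funext A _ _ _
    refine MonoidHom.ext fun t => unitComponent_injective (Ω := Ω) fun φ => ?_
    rw [unitComponent_reciprocity_zpow S hl', hf]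

/-! ### The kernel -/

omit [IsCMField E] in
lemma mem_ker_reciprocity_iff {S : Set (E →ₐ[ℚ] Ec)} {A : Type u} [CommRing A]
    [Algebra ℚ A] [Algebra Ω A] {x : ResPoints (ReflexField S) A} :
    haveI := finiteDimensional_reflexField S
    x ∈ (reciprocity S).ker.points A ↔ ∀ φ : E →ₐ[ℚ] Ω,
      ∏ ψ : ReflexField S →ₐ[ℚ] Ω, (if φ ∈ translate S ψ then unitComponent A ψ x else 1) = 1 := by
  have := finiteDimensional_reflexField S
  change (reciprocity S).app A x = 1 ↔ _
  constructor
  · intro h φ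
    rw [← unitComponent_reciprocity, h, map_one]
  · intro h
    refine unitComponent_injective (Ω := Ω) fun φ => ?_
    rw [unitComponent_reciprocity, h, map_one]

/-- If all CM types are translates of `S`, the kernel of the reciprocity morphism is connected.
Over `Ω` it is the diagonalizable group whose character group is the cokernel of `cospanHom`,
which is torsion-free, so that its group ring is a domain. -/
theorem isConnected_ker_reciprocity {S : Set (E →ₐ[ℚ] Ec)} (hS : IsCMType E S)
    (htr : ∀ T : Set (E →ₐ[ℚ] Ω), IsCMType E T → ∃ ψ : ReflexField S →ₐ[ℚ] Ω, translate S ψ = T) :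
    (reciprocity S).ker.IsConnected := by
  have := finiteDimensional_reflexField S
  have : Nonempty (E →ₐ[ℚ] Ω) := ⟨IsAlgClosed.lift⟩
  let N := cospanHom (translate (Ω := Ω) S)
  let Q := ((ReflexField S →ₐ[ℚ] Ω) → ℤ) ⧸ N.range
  have hQ : IsAddTorsionFree Q := by
    refine ⟨fun n hn => ?_⟩
    intro a b hab
    obtain ⟨m, rfl⟩ := QuotientAddGroup.mk_surjective a
    obtain ⟨m', rfl⟩ := QuotientAddGroup.mk_surjective b
    have hab : ((n • m : (ReflexField S →ₐ[ℚ] Ω) → ℤ) : Q) = (n • m' : (_ → ℤ)) := hab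
    rw [QuotientAddGroup.eq, neg_add_eq_sub, ← nsmul_sub, ← natCast_zsmul] at hab
    rw [QuotientAddGroup.eq, neg_add_eq_sub]
    exact mem_range_cospanHom_of_smul (isCMType_translate hS) htr (Nat.cast_ne_zero.2 hn) hab
  let D := AddMonoidAlgebra Ω Q
  have : AddMonoid.FG Q := inferInstance
  have : IsDomain D := NoZeroDivisors.to_isDomain D
  -- the characters of the diagonalizable group, as units of its coordinate ring
  let χ : Multiplicative Q →* Dˣ := (Units.map (AddMonoidAlgebra.of Ω Q)).comp toUnits.toMonoidHom
  obtain ⟨d, hd⟩ := exists_unitComponent_eq (K := ReflexField S) (A := D) (Ω := Ω)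
    fun ψ => χ (.ofAdd (QuotientAddGroup.mk (Pi.single ψ 1)))
  refine (reciprocity S).ker_isClosed.isConnected_of_isDomain (Ω := Ω) (D := D) d ?_ ?_
  · refine (mem_ker_reciprocity_iff (Ω := Ω)).2 fun φ => ?_
    have h1 : ∑ ψ, (if φ ∈ translate S ψ then Pi.single ψ 1 else 0) = N (Pi.single φ 1) := by
      funext ψ
      rw [Finset.sum_apply, Finset.sum_eq_single ψ]
      · simp only [N, cospanHom, AddMonoidHom.coe_mk, ZeroHom.coe_mk, typeSum_single]
        split_ifs <;> simp
      · intro ψ' _ h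
        split_ifs <;> simp [h.symm]
      · simp
    let e : Multiplicative ((ReflexField S →ₐ[ℚ] Ω) → ℤ) →* Dˣ :=
      χ.comp (QuotientAddGroup.mk' N.range).toMultiplicative
    have h2 : e (.ofAdd (N (Pi.single φ 1))) = 1 := by
      have : (QuotientAddGroup.mk (N (Pi.single φ 1)) : Q) = 0 :=
        (QuotientAddGroup.eq_zero_iff _).2 ⟨_, rfl⟩
      exact (congrArg (fun q => χ (.ofAdd q)) this).trans (map_one χ)
    refine Eq.trans ?_ h2
    rw [← h1, ofAdd_sum, map_prod]
    refine Finset.prod_congr rfl fun ψ _ => ?_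
    split_ifs
    · exact hd ψ
    · exact (map_one e).symm
  · intro A _ _ _ x hx
    have hx := (mem_ker_reciprocity_iff (Ω := Ω)).1 hx
    -- the characters of the diagonalizable group, evaluated at `x`
    let h₀ : ((ReflexField S →ₐ[ℚ] Ω) → ℤ) →+ Additive Aˣ :=
      ∑ ψ, (zmultiplesHom _ (.ofMul (unitComponent A ψ x))).comp (Pi.evalAddMonoidHom _ ψ)
    have hsum : ∀ m, h₀ m = ∑ ψ, m ψ • Additive.ofMul (unitComponent A ψ x) := by simp [h₀]
    have hN : N.range ≤ h₀.ker := by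
      have : h₀.comp N = 0 := by
        refine AddMonoidHom.functions_ext _ _ _ fun φ k => ?_
        have h1 : ∀ ψ, N (Pi.single φ k) ψ • Additive.ofMul (unitComponent A ψ x) =
            k • Additive.ofMul (if φ ∈ translate S ψ then unitComponent A ψ x else 1) := by
          intro ψ
          change typeSum (translate S ψ) (Pi.single φ k) • _ = _
          rw [typeSum_single]
          split_ifs <;> simp
        rw [AddMonoidHom.comp_apply, hsum, Finset.sum_congr rfl fun ψ _ => h1 ψ,
          Finset.sum_zsmul, ← ofMul_prod, hx]
        simp
      rintro _ ⟨c, rfl⟩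
      exact DFunLike.congr_fun this c
    let h₁ : Q →+ Additive Aˣ := QuotientAddGroup.lift N.range h₀ hN
    let F : D →ₐ[Ω] A := AddMonoidAlgebra.lift Ω A Q ((Units.coeHom A).comp h₁.toMultiplicativeLeft)
    refine ⟨F, unitComponent_injective (Ω := Ω) fun ψ => ?_⟩
    rw [unitComponent_map, hd]
    have h2 : h₁ (QuotientAddGroup.mk (Pi.single ψ 1)) = .ofMul (unitComponent A ψ x) := by
      change h₀ (Pi.single ψ 1) = _
      rw [hsum, Finset.sum_eq_single ψ]
      · simp
      · intro ψ' _ h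
        simp [h]
      · simp
    ext
    refine (AddMonoidAlgebra.lift_single _ _ _).trans ?_
    rw [one_smul]
    exact congrArg (fun a : Additive Aˣ => (a.toMul : A)) h2

end Main

end CMTorus

open CMTorus
theorem proposition4p3
    {E : Type u} [Field E] [NumberField E] [NumberField.IsCMField E]
    -- `Ec` is a Galois closure of `E` over `ℚ`
    {Ec : Type u} [Field Ec] [Algebra ℚ Ec] [IsNormalClosure ℚ E Ec]
    -- `Ω` is an algebraic closure of `ℚ`
    {Ω : Type u} [Field Ω] [Algebra ℚ Ω] [IsAlgClosure ℚ Ω]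
    -- a CM type on `E`
    (S : Set (E →ₐ[ℚ] Ec)) (hS : IsCMType E S)
    (g v : ℕ) (hg : Module.finrank ℚ E = 2 * g)
    -- the exact sequence `1 → (ℤ/2)^v → Gal(Ec/ℚ) → Gal(Fc/ℚ) → 1`
    (ι : Multiplicative (Fin v → ZMod 2) →* (Ec ≃ₐ[ℚ] Ec)) (hι : Function.Injective ι)
    (hexact : ι.range = (restrictGal E Ec).ker)
    (hv : v = g) :
    Lmu S Ω = (GU E).cocharacters Ω ∧
      (reciprocity S).ker.IsConnected := by
  have : IsAlgClosed Ω := IsAlgClosure.isAlgClosed ℚ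
  have hcard : Nat.card (restrictGal E Ec).ker = 2 ^ g := by
    rw [← hexact, ← hv, ← Nat.card_congr (MonoidHom.ofInjective hι).toEquiv]
    simp
  have htr := fun (T : Set (E →ₐ[ℚ] Ω)) (hT : IsCMType E T) =>
    exists_translate_eq hg hcard hS hT
  exact ⟨Lmu_eq_cocharacters_GU hS htr, isConnected_ker_reciprocity hS htr⟩
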